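/- Let $d\ge 1$, $N\ge 0$, let $U\subset\mathbb R^d$ be open and bounded, and let $\Gamma=[-1,1]^N$. Let $\mu_1,\dots,\mu_N\ge 0$, $b_1,\dots,b_N\in W^{1,\infty}(U)$ and $v\in C^1(U;\mathbb R^d)$. For ${\bf y}\in\Gamma$ define the domain map $$F(x,{\bf y})=x+\Big(\sum_{l=1}^N\sqrt{\mu_l}\,b_l(x)\,y_l\Big)v(x),\qquad x\in U,$$ and assume that the domain $D({\bf y})=F(U,{\bf y})$ is bounded for every ${\bf y}\in\Gamma$. With $B_l(x)=b_l(x)\,\partial v(x)+v(x)\,\nabla b_l(x)^T$, the Jacobian of $F$ is $\partial F(x,{\bf y})=I+\sum_{l}\sqrt{\mu_l}\,y_l\,B_l(x)$. Assume that for some $0<\tilde\delta<1$ $$\sum_{l=1}^N\|B_l(x)\|_2\sqrt{\mu_l}\le 1-\tilde\delta\qquad\text{for a.e. }x\in U,$$ where $\|\cdot\|_2$ is the spectral norm. Let the diffusion coefficient, pulled back to $U$, be a measurable function $\hat a=a\circ F:U\to\mathbb R$ that does not depend on ${\bf y}$ and satisfies $0<a_{\min}\le\hat a\le a_{\max}<\infty$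 a.e. in $U$. Let $f:\mathbb R^d\to\mathbb R$ be the restriction to $\mathbb R^d$ of an entire function on $\mathbb C^d$, and let $\hat w\in H^1(U)$, independent of ${\bf y}$, be an extension of the Dirichlet data. For ${\bf y}\in\Gamma$ consider the problem remapped to $U$: find $\hat u=(\tilde u\circ F)(\cdot,{\bf y})\in H^1_0(U)$ such that for all $\varphi\in H^1_0(U)$ $$\int_U \hat a\,(\nabla\hat u)^TC^{-1}\nabla\varphi\,|\partial F|\,dx=\int_U (f\circ F)\,|\partial F|\,\varphi\,dx-\int_U\hat a\,(\nabla\hat w)^TC^{-1}\nabla\varphi\,|\partial F|\,dx,$$ where $C=\partial F^T\partial F$ and $|\partial F|=|\det\partial F|$. Define $$\Theta_\beta=\Big\{{\bf y}+{\bf w}:\ {\bf y}\in[-1,1]^N,\ {\bf w}\in\mathbb C^N,\ \sum_{l=1}^N\sup_{x\in U}\|B_l(x)\|_2\sqrt{\mu_l}\,|w_l|\le\beta\Big\}$$ (with the essential supremum over $U$) and suppose that $$\beta<\min\Big\{\frac{\tilde\delta\log\gamma}{d+\log\gamma},\ \sqrt{1+\tilde\delta^2/2}-1\Big\},\qquad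 \gamma=\frac{2\tilde\delta^{d}+(2-\tilde\delta)^d}{\tilde\delta^{d}+(2-\tilde\delta)^d}.$$ Then for every ${\bf y}\in\Gamma$ the remapped problem has a unique solution $(\tilde u\circ F)(\cdot,{\bf y})\in H^1_0(U)$, and the map $\Gamma\ni{\bf y}\mapsto(\tilde u\circ F)(\cdot,{\bf y})$ extends holomorphically to $\Theta_\beta\subset\mathbb C^N$: there are an open set $V\supseteq\Theta_\beta$ in $\mathbb C^N$ and a map $\Psi$ with values in the complex space $H^1_0(U;\mathbb C)$ that is holomorphic on $V$ and satisfies $\Psi({\bf y})=(\tilde u\circ F)(\cdot,{\bf y})$ for all ${\bf y}\in\Gamma$. -/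

import Mathlib

open MeasureTheory Set
open scoped ContDiff

noncomputable section

/-- Smooth test functions `φ ∈ C_c^∞(U; 𝕜)`. -/
def IsTestFunction {d : ℕ} {𝕜 : Type*} [RCLike 𝕜] (U : Set (EuclideanSpace ℝ (Fin d)))
    (φ : EuclideanSpace ℝ (Fin d) → 𝕜) : Prop :=
  ContDiff ℝ ∞ φ ∧ HasCompactSupport φ ∧ tsupport φ ⊆ U

/-- The classical gradient `(∂₁φ, …, ∂_dφ)` of a `𝕜`-valued function of a real variable `x ∈ ℝ^d`. -/
def classicalGradient {d : ℕ} {𝕜 : Type*} [RCLike 𝕜] (φ : EuclideanSpace ℝ (Fin d) → 𝕜)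
    (x : EuclideanSpace ℝ (Fin d)) : EuclideanSpace 𝕜 (Fin d) :=
  WithLp.toLp 2 fun i => fderiv ℝ φ x (EuclideanSpace.single i 1)

/-- `w ∈ W^{1,p}(U)` (real valued) with weak gradient `Dw`. -/
def MemSobolevOne {d : ℕ} (p : ENNReal) (U : Set (EuclideanSpace ℝ (Fin d)))
    (w : EuclideanSpace ℝ (Fin d) → ℝ)
    (Dw : EuclideanSpace ℝ (Fin d) → EuclideanSpace ℝ (Fin d)) : Prop :=
  MemLp w p (volume.restrict U) ∧ MemLp Dw p (volume.restrict U) ∧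
    ∀ φ : EuclideanSpace ℝ (Fin d) → ℝ, IsTestFunction U φ → ∀ i : Fin d,
      ∫ x in U, w x * classicalGradient φ x i = -∫ x in U, Dw x i * φ x

/-- The Hilbert space `L²(U; 𝕜) × L²(U; 𝕜^d)`, with `‖(u, q)‖² = ‖u‖² + ‖q‖²`. -/
abbrev L2Pair {d : ℕ} (𝕜 : Type*) [RCLike 𝕜] (U : Set (EuclideanSpace ℝ (Fin d))) : Type _ :=
  WithLp 2 (Lp 𝕜 2 (volume.restrict U) × Lp (EuclideanSpace 𝕜 (Fin d)) 2 (volume.restrict U))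

/-- The pairs `(φ, ∇φ)` with `φ ∈ C_c^∞(U; 𝕜)`. -/
def testPairs {d : ℕ} (𝕜 : Type*) [RCLike 𝕜] (U : Set (EuclideanSpace ℝ (Fin d))) :
    Set (L2Pair 𝕜 U) :=
  {p | ∃ φ : EuclideanSpace ℝ (Fin d) → 𝕜, IsTestFunction U φ ∧
    p.fst =ᵐ[volume.restrict U] φ ∧ p.snd =ᵐ[volume.restrict U] classicalGradient φ}

/-- `H¹₀(U; 𝕜)`: the closure of `C_c^∞(U; 𝕜)` in the `H¹` norm, every function `u` being stored
together with its weak gradient as the pair `(u, ∇u)`. -/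
abbrev H10 {d : ℕ} (𝕜 : Type*) [RCLike 𝕜] (U : Set (EuclideanSpace ℝ (Fin d))) :
    Submodule 𝕜 (L2Pair 𝕜 U) :=
  (Submodule.span 𝕜 (testPairs 𝕜 U)).topologicalClosure

/-- The function underlying an element of `H¹₀(U; 𝕜)`. -/
def h10Fun {d : ℕ} {𝕜 : Type*} [RCLike 𝕜] {U : Set (EuclideanSpace ℝ (Fin d))}
    (u : H10 𝕜 U) : EuclideanSpace ℝ (Fin d) → 𝕜 :=
  (u : L2Pair 𝕜 U).fst

/-- The weak gradient of an element of `H¹₀(U; 𝕜)`. -/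
def h10Grad {d : ℕ} {𝕜 : Type*} [RCLike 𝕜] {U : Set (EuclideanSpace ℝ (Fin d))}
    (u : H10 𝕜 U) : EuclideanSpace ℝ (Fin d) → EuclideanSpace 𝕜 (Fin d) :=
  (u : L2Pair 𝕜 U).snd

/-- `ψ ∈ H¹₀(U; ℂ)` is the real-valued function `u ∈ H¹₀(U; ℝ)`, seen as a complex-valued one. -/
def IsComplexificationOf {d : ℕ} {U : Set (EuclideanSpace ℝ (Fin d))}
    (ψ : H10 ℂ U) (u : H10 ℝ U) : Prop :=
  (∀ᵐ x ∂volume.restrict U, h10Fun ψ x = ((h10Fun u x : ℝ) : ℂ)) ∧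
    ∀ᵐ x ∂volume.restrict U, ∀ i : Fin d, h10Grad ψ x i = ((h10Grad u x i : ℝ) : ℂ)

/-- The domain map `F(x, y) = x + (∑ₗ √μₗ bₗ(x) yₗ) v(x)`. -/
def domainMap {d N : ℕ} (μ : Fin N → ℝ) (b : Fin N → EuclideanSpace ℝ (Fin d) → ℝ)
    (v : EuclideanSpace ℝ (Fin d) → EuclideanSpace ℝ (Fin d)) (y : Fin N → ℝ)
    (x : EuclideanSpace ℝ (Fin d)) : EuclideanSpace ℝ (Fin d) :=
  x + (∑ l, √(μ l) * b l x * y l) • v x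

/-- `B(x) = b(x) ∂v(x) + v(x) ∇b(x)ᵀ`, where `Db` is the weak gradient of `b`. -/
def perturbationMatrix {d : ℕ} (b : EuclideanSpace ℝ (Fin d) → ℝ)
    (Db : EuclideanSpace ℝ (Fin d) → EuclideanSpace ℝ (Fin d))
    (v : EuclideanSpace ℝ (Fin d) → EuclideanSpace ℝ (Fin d))
    (x : EuclideanSpace ℝ (Fin d)) : Matrix (Fin d) (Fin d) ℝ :=
  Matrix.of fun i j => b x * (fderiv ℝ v x (EuclideanSpace.single j 1)) i + v x i * Db x j

/-- The Jacobian `∂F(x, y) = I + ∑ₗ √μₗ yₗ Bₗ(x)` of the domain map. -/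
def domainJacobian {d N : ℕ} (μ : Fin N → ℝ) (b : Fin N → EuclideanSpace ℝ (Fin d) → ℝ)
    (Db : Fin N → EuclideanSpace ℝ (Fin d) → EuclideanSpace ℝ (Fin d))
    (v : EuclideanSpace ℝ (Fin d) → EuclideanSpace ℝ (Fin d)) (y : Fin N → ℝ)
    (x : EuclideanSpace ℝ (Fin d)) : Matrix (Fin d) (Fin d) ℝ :=
  1 + ∑ l, (√(μ l) * y l) • perturbationMatrix (b l) (Db l) v x

/-- The spectral norm (largest singular value) `‖A‖₂`. -/
def spectralNorm₂ {d : ℕ} (A : Matrix (Fin d) (Fin d) ℝ) : ℝ :=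
  ‖Matrix.toEuclideanCLM (n := Fin d) (𝕜 := ℝ) A‖

/-- `sup_{x ∈ U} ‖B(x)‖₂`, as an essential supremum because `B` is defined almost everywhere. -/
def supSpectralNorm {d : ℕ} (U : Set (EuclideanSpace ℝ (Fin d)))
    (B : EuclideanSpace ℝ (Fin d) → Matrix (Fin d) (Fin d) ℝ) : ℝ :=
  (eLpNorm (fun x => spectralNorm₂ (B x)) ⊤ (volume.restrict U)).toReal

/-- The matrix `a(x) C(x,y)⁻¹ |det ∂F(x,y)|` with `C = ∂Fᵀ ∂F`, for the Jacobian `J = ∂F(x,y)`. -/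
def pulledBackCoefficient {d : ℕ} (a : ℝ) (J : Matrix (Fin d) (Fin d) ℝ) :
    Matrix (Fin d) (Fin d) ℝ :=
  (a * |J.det|) • (J.transpose * J)⁻¹

/-- `u ∈ H¹₀(U)` is a weak solution of the Dirichlet problem remapped to the reference domain,
`∫_U a (∇u)ᵀ C⁻¹ ∇φ |∂F| = ∫_U (f ∘ F) |∂F| φ - ∫_U a (∇w)ᵀ C⁻¹ ∇φ |∂F|` for all `φ ∈ H¹₀(U)`;
here `a` is the diffusion coefficient on the reference domain and `Dw` the gradient of the
extension `w` of the boundary data. -/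
def IsRemappedSolution {d N : ℕ} (U : Set (EuclideanSpace ℝ (Fin d)))
    (μ : Fin N → ℝ) (b : Fin N → EuclideanSpace ℝ (Fin d) → ℝ)
    (Db : Fin N → EuclideanSpace ℝ (Fin d) → EuclideanSpace ℝ (Fin d))
    (v : EuclideanSpace ℝ (Fin d) → EuclideanSpace ℝ (Fin d))
    (a f : EuclideanSpace ℝ (Fin d) → ℝ)
    (Dw : EuclideanSpace ℝ (Fin d) → EuclideanSpace ℝ (Fin d))
    (y : Fin N → ℝ) (u : H10 ℝ U) : Prop :=
  ∀ φ : H10 ℝ U,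
    ∫ x in U, (h10Grad u x).ofLp ⬝ᵥ
        Matrix.mulVec (pulledBackCoefficient (a x) (domainJacobian μ b Db v y x)) (h10Grad φ x).ofLp
      = (∫ x in U, f (domainMap μ b v y x) * |(domainJacobian μ b Db v y x).det| * h10Fun φ x)
        - ∫ x in U, (Dw x).ofLp ⬝ᵥ
            Matrix.mulVec (pulledBackCoefficient (a x) (domainJacobian μ b Db v y x))
              (h10Grad φ x).ofLp

/-- `Θ_β = { y + w : y ∈ [-1,1]^N, w ∈ ℂ^N, ∑ₗ sup_x ‖Bₗ(x)‖₂ √μₗ |wₗ| ≤ β }`. -/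
def complexRegion {d N : ℕ} (U : Set (EuclideanSpace ℝ (Fin d)))
    (μ : Fin N → ℝ) (b : Fin N → EuclideanSpace ℝ (Fin d) → ℝ)
    (Db : Fin N → EuclideanSpace ℝ (Fin d) → EuclideanSpace ℝ (Fin d))
    (v : EuclideanSpace ℝ (Fin d) → EuclideanSpace ℝ (Fin d)) (β : ℝ) : Set (Fin N → ℂ) :=
  {z | ∃ y ∈ Icc (-1 : Fin N → ℝ) 1, ∃ w : Fin N → ℂ, (∀ l, z l = (y l : ℂ) + w l) ∧
    ∑ l, supSpectralNorm U (perturbationMatrix (b l) (Db l) v) * √(μ l) * ‖w l‖ ≤ β}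

/-- `γ = (2δ^d + (2-δ)^d) / (δ^d + (2-δ)^d)`. -/
def gammaConst (d : ℕ) (δ : ℝ) : ℝ :=
  (2 * δ ^ d + (2 - δ) ^ d) / (δ ^ d + (2 - δ) ^ d)

end

/-! For real parameters `det ∂F > 0`, so the absolute value can be dropped. The coefficient `a det J
(JᵀJ)⁻¹` and the source `f(F) det J` then make sense for complex parameters and are holomorphic in
them, because the transpose involves no conjugation. The point is to keep the complex problem
uniformly elliptic (`coefficientMatrix_coercive`).

Write `J = J₀ + W` with `J₀ = 1 + E` real and `W` small. With `p = J⁻ᵀq` the quadratic form of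
`J⁻¹J⁻ᵀ` at `q` becomes `⟪p, conj(J) J⁻¹ p⟫`, and `conj(J) J⁻¹ = 1 - 2i S J⁻¹`, where `S` is the
imaginary part of `W`. The form is therefore `‖p‖²` up to a relative error of at most `0.84`.
Moreover `det J = det J₀ · A` with `A = det(1 + J₀⁻¹W)` in the disc of radius `1/2` about `1`, so
the argument of `A` is at most 30 degrees. Since `cos 30° > 0.86 > 0.84`, the real part stays
positive. The bound on `β` through `γ` supplies both smallness conditions (`radius_bounds`).

With the Poincaré inequality, coercivity makes the stiffness operator on `H¹₀` invertible
(`isUnit_stiffness`). Uniform bounds and Cauchy estimates turn pointwise holomorphy of the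
coefficient and the source into holomorphy with values in `L^∞` (`differentiableAt_Lp_top`).
Operator and load depend on these linearly and continuously, and inversion is holomorphic, so the
solution is holomorphic (`exists_differentiableOn_solution`). At real parameters the complexified
real solution solves the complex equation, and uniqueness identifies the two. -/

/-! ### Matrix estimates: determinants, inverses and coercivity of the complex coefficient. -/

section Pointwise

open scoped Matrix.Norms.L2Operator InnerProductSpace

variable {d : ℕ}

/-- The determinant of `1 + E` is a product of `d` factors `1 + λᵢ` with `|λᵢ| ≤ ‖E‖`. -/
theorem exists_det_one_add_eq_prod (E : Matrix (Fin d) (Fin d) ℂ) :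
    ∃ r : Fin d → ℂ, (∀ i, ‖r i‖ ≤ ‖E‖) ∧ (1 + E).det = ∏ i, (1 + r i) := by
  obtain rfl | hd := d.eq_zero_or_pos
  · exact ⟨0, fun i => i.elim0, by simp⟩
  have : Nonempty (Fin d) := ⟨⟨0, hd⟩⟩
  set s := (1 + E).charpoly.roots with hs
  have hcard : s.toList.length = d := by
    rw [Multiset.length_toList, hs,
      ← (IsAlgClosed.splits (1 + E).charpoly).natDegree_eq_card_roots,
      Matrix.charpoly_natDegree_eq_dim, Fintype.card_fin]
  refine ⟨fun i => s.toList.get (i.cast hcard.symm) - 1, fun i => ?_, ?_⟩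
  · have hmem : s.toList.get (i.cast hcard.symm) ∈ s :=
      Multiset.mem_toList.1 (List.get_mem _ _)
    have hroot := Polynomial.isRoot_of_mem_roots hmem
    have hspec : s.toList.get (i.cast hcard.symm) ∈ spectrum ℂ (1 + E) :=
      Matrix.mem_spectrum_of_isRoot_charpoly hroot
    have : s.toList.get (i.cast hcard.symm) - 1 ∈ spectrum ℂ E := by
      rw [spectrum.mem_iff] at hspec ⊢
      convert hspec using 2
      rw [map_sub, map_one]; abel
    exact spectrum.norm_le_norm_of_mem this
  · rw [Matrix.det_eq_prod_roots_charpoly, ← hs]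
    conv_lhs => rw [← Multiset.coe_toList s, Multiset.prod_coe]
    rw [← List.prod_ofFn]
    congr 1
    apply List.ext_get
    · simp [hcard]
    · intro n h1 h2
      simp

/-- Expanding the product over eigenvalues gives `|∏(1 + rᵢ) - 1| ≤ exp(∑|rᵢ|) - 1`. The exponential
form is what `log γ` is matched against later. -/
theorem norm_det_one_add_sub_one_le (E : Matrix (Fin d) (Fin d) ℂ) :
    ‖(1 + E).det - 1‖ ≤ Real.exp (d * ‖E‖) - 1 := by
  obtain ⟨r, hr, h⟩ := exists_det_one_add_eq_prod E
  rw [h]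
  refine (Finset.norm_prod_one_add_sub_one_le _ _).trans ?_
  gcongr
  simpa using Finset.sum_le_sum fun i (_ : i ∈ Finset.univ) => hr i

theorem norm_det_one_add_le (E : Matrix (Fin d) (Fin d) ℂ) :
    ‖(1 + E).det‖ ≤ Real.exp (d * ‖E‖) := by
  have h1 := norm_det_one_add_sub_one_le E
  have h2 := norm_sub_norm_le (1 + E).det 1
  rw [norm_one] at h2
  linarith

theorem pow_le_norm_det_one_add {E : Matrix (Fin d) (Fin d) ℂ} {ε : ℝ} (hε : 0 ≤ ε)
    (hE : ‖E‖ ≤ 1 - ε) : ε ^ d ≤ ‖(1 + E).det‖ := by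
  obtain ⟨r, hr, h⟩ := exists_det_one_add_eq_prod E
  rw [h, norm_prod]
  calc ε ^ d = ∏ _i : Fin d, ε := by simp
    _ ≤ _ := Finset.prod_le_prod (fun _ _ => hε) fun i _ => by
      have := norm_sub_norm_le (1 : ℂ) (-(r i))
      rw [norm_one, norm_neg, sub_neg_eq_add] at this
      linarith [hr i]

/-- No Neumann series is needed: `X = (1 + E)⁻¹` exists by the determinant bound and satisfies `X =
1 - EX`, so `‖X‖ ≤ 1 + (1 - ε)‖X‖`, which is solved for `‖X‖`. -/
theorem norm_one_add_inv_le {E : Matrix (Fin d) (Fin d) ℂ} {ε : ℝ} (hε : 0 < ε)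
    (hE : ‖E‖ ≤ 1 - ε) : IsUnit (1 + E).det ∧ ‖(1 + E)⁻¹‖ ≤ ε⁻¹ := by
  have hu : IsUnit (1 + E).det := by
    rw [isUnit_iff_ne_zero, ← norm_pos_iff]
    exact (pow_pos hε d).trans_le (pow_le_norm_det_one_add hε.le hE)
  refine ⟨hu, ?_⟩
  have h1 : (1 + E)⁻¹ = 1 - E * (1 + E)⁻¹ := by
    have := Matrix.mul_nonsing_inv _ hu
    rw [add_mul, one_mul] at this
    exact eq_sub_of_add_eq this
  have hone : ‖(1 : Matrix (Fin d) (Fin d) ℂ)‖ ≤ 1 := by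
    obtain h | h := isEmpty_or_nonempty (Fin d)
    · rw [Subsingleton.elim (1 : Matrix (Fin d) (Fin d) ℂ) 0]; simp
    · exact CStarRing.norm_one.le
  have h2 : ‖(1 + E)⁻¹‖ ≤ 1 + ‖E‖ * ‖(1 + E)⁻¹‖ := by
    conv_lhs => rw [h1]
    exact (norm_sub_le _ _).trans (add_le_add hone (norm_mul_le _ _))
  have h3 := norm_nonneg (1 + E)⁻¹
  rw [inv_eq_one_div ε, le_div_iff₀ hε]
  nlinarith

/-- Extending the scalars of a matrix from `ℝ` to `ℂ`. -/
abbrev complexMatrix (A : Matrix (Fin d) (Fin d) ℝ) : Matrix (Fin d) (Fin d) ℂ :=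
  A.map Complex.ofRealHom

/-- A real matrix acts separately on the real and imaginary parts of a vector, and the squared norms
of the two parts add up. -/
theorem norm_complexMatrix_le (A : Matrix (Fin d) (Fin d) ℝ) : ‖complexMatrix A‖ ≤ ‖A‖ := by
  rw [← Matrix.l2_opNorm_toEuclideanCLM]
  refine ContinuousLinearMap.opNorm_le_bound _ (norm_nonneg _) fun p => ?_
  have hsplit : ∀ q : EuclideanSpace ℂ (Fin d), ‖q‖ ^ 2 =
      ‖(WithLp.toLp 2 fun i => (q i).re : EuclideanSpace ℝ (Fin d))‖ ^ 2 +
        ‖(WithLp.toLp 2 fun i => (q i).im : EuclideanSpace ℝ (Fin d))‖ ^ 2 := fun q => by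
    simp only [EuclideanSpace.norm_sq_eq, ← Finset.sum_add_distrib]
    refine Finset.sum_congr rfl fun i _ => ?_
    rw [Complex.sq_norm, Complex.normSq_apply, Real.norm_eq_abs, Real.norm_eq_abs, sq_abs, sq_abs]
    ring
  rw [← sq_le_sq₀ (norm_nonneg _) (by positivity), mul_pow, hsplit, hsplit p, mul_add]
  have hre : (WithLp.toLp 2 fun i =>
      ((Matrix.toEuclideanCLM (n := Fin d) (𝕜 := ℂ) (complexMatrix A) p) i).re :
        EuclideanSpace ℝ (Fin d)) =
      Matrix.toEuclideanCLM (n := Fin d) (𝕜 := ℝ) A (WithLp.toLp 2 fun i => (p i).re) := by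
    ext i
    simp [Matrix.mulVec, dotProduct]
  have him : (WithLp.toLp 2 fun i =>
      ((Matrix.toEuclideanCLM (n := Fin d) (𝕜 := ℂ) (complexMatrix A) p) i).im :
        EuclideanSpace ℝ (Fin d)) =
      Matrix.toEuclideanCLM (n := Fin d) (𝕜 := ℝ) A (WithLp.toLp 2 fun i => (p i).im) := by
    ext i
    simp [Matrix.mulVec, dotProduct]
  rw [hre, him]
  simp only [← mul_pow]
  gcongr <;> exact ContinuousLinearMap.le_opNorm _ _

theorem norm_map_star_le (A : Matrix (Fin d) (Fin d) ℂ) : ‖A.map star‖ ≤ ‖A‖ := by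
  rw [← Matrix.l2_opNorm_toEuclideanCLM]
  refine ContinuousLinearMap.opNorm_le_bound _ (norm_nonneg _) fun p => ?_
  have hnorm : ∀ q : EuclideanSpace ℂ (Fin d),
      ‖(WithLp.toLp 2 fun i => star (q i) : EuclideanSpace ℂ (Fin d))‖ = ‖q‖ := fun q => by
    simp [EuclideanSpace.norm_eq]
  have h : Matrix.toEuclideanCLM (n := Fin d) (𝕜 := ℂ) (A.map star) p = WithLp.toLp 2 fun i =>
      star (Matrix.toEuclideanCLM (n := Fin d) (𝕜 := ℂ) A (WithLp.toLp 2 fun i => star (p i)) i) := by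
    ext i
    simp [Matrix.mulVec, dotProduct]
  rw [h, hnorm, ← hnorm p]
  exact ContinuousLinearMap.le_opNorm _ _

theorem norm_transpose_le (A : Matrix (Fin d) (Fin d) ℂ) : ‖A.transpose‖ ≤ ‖A‖ := by
  have h : A.transpose = (A.map star).conjTranspose := by
    ext i j; simp
  rw [h, Matrix.l2_opNorm_conjTranspose]
  exact norm_map_star_le A

theorem det_complexMatrix (A : Matrix (Fin d) (Fin d) ℝ) :
    (complexMatrix A).det = (A.det : ℂ) :=
  ((Complex.ofRealHom : ℝ →+* ℂ).map_det A).symm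

/-- The determinant does not vanish along the segment from `1` to `1 + E`, hence keeps the sign it
has at `1`. -/
theorem det_one_add_pos {E : Matrix (Fin d) (Fin d) ℝ} (hE : ‖E‖ < 1) : 0 < (1 + E).det := by
  have hne : ∀ t ∈ Icc (0 : ℝ) 1, (1 + t • E).det ≠ 0 := fun t ht h0 => by
    have h1 : ‖complexMatrix (t • E)‖ ≤ 1 - (1 - ‖E‖) := by
      refine (norm_complexMatrix_le _).trans ?_
      rw [norm_smul, Real.norm_of_nonneg ht.1]
      nlinarith [norm_nonneg E, ht.2]
    have h2 := (norm_one_add_inv_le (by linarith) h1).1.ne_zero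
    apply h2
    rw [show (1 : Matrix (Fin d) (Fin d) ℂ) + complexMatrix (t • E) = complexMatrix (1 + t • E) by
      simp [complexMatrix, Matrix.map_add], det_complexMatrix, h0, Complex.ofReal_zero]
  by_contra! hle
  have hc : ContinuousOn (fun t : ℝ => (1 + t • E).det) (Icc 0 1) := by
    apply Continuous.continuousOn
    apply Continuous.matrix_det
    fun_prop
  obtain ⟨t, ht, h0⟩ := intermediate_value_Icc' (zero_le_one' ℝ) hc
    (show (0 : ℝ) ∈ Icc _ _ by simpa using hle)
  exact hne t ht h0

/-- The matrix `a det(J) (Jᵀ J)⁻¹`. -/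
noncomputable def coefficientMatrix {𝕜 : Type*} [RCLike 𝕜] (a : ℝ) (J : Matrix (Fin d) (Fin d) 𝕜) :
    Matrix (Fin d) (Fin d) 𝕜 :=
  ((a : 𝕜) * J.det) • (J.transpose * J)⁻¹

theorem coefficientMatrix_eq {𝕜 : Type*} [RCLike 𝕜] (a : ℝ) (J : Matrix (Fin d) (Fin d) 𝕜) :
    coefficientMatrix a J = ((a : 𝕜) * J.det) • (J⁻¹ * (J⁻¹).transpose) := by
  rw [coefficientMatrix, Matrix.mul_inv_rev, Matrix.transpose_nonsing_inv]

theorem complexMatrix_coefficientMatrix (a : ℝ) (J : Matrix (Fin d) (Fin d) ℝ) :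
    complexMatrix (coefficientMatrix a J) = coefficientMatrix a (complexMatrix J) := by
  have hadj : ∀ M : Matrix (Fin d) (Fin d) ℝ,
      (complexMatrix M).adjugate = complexMatrix M.adjugate :=
    fun M => (RingHom.map_adjugate Complex.ofRealHom M).symm
  have hmul : (complexMatrix J).transpose * complexMatrix J =
      complexMatrix (J.transpose * J) := by
    simp [complexMatrix, Matrix.map_mul, Matrix.transpose_map]
  ext i j
  simp only [coefficientMatrix, hmul, det_complexMatrix, Matrix.inv_def, hadj]
  simp

theorem norm_coefficientMatrix_le {a M ε : ℝ} (ha : |a| ≤ M) (hε : 0 < ε)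
    {E : Matrix (Fin d) (Fin d) ℂ} (hE : ‖E‖ ≤ 1 - ε) :
    ‖coefficientMatrix a (1 + E)‖ ≤ M * Real.exp d * (ε⁻¹ * ε⁻¹) := by
  obtain ⟨-, hinv⟩ := norm_one_add_inv_le hε hE
  have h1 : Real.exp (d * ‖E‖) ≤ Real.exp d := by
    gcongr
    nlinarith [norm_nonneg E, (Nat.cast_nonneg d : (0 : ℝ) ≤ d)]
  rw [coefficientMatrix_eq, norm_smul, norm_mul]
  refine mul_le_mul (mul_le_mul ?_ ((norm_det_one_add_le E).trans h1) (norm_nonneg _)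
    ((abs_nonneg a).trans ha)) ?_ (norm_nonneg _) ?_
  · simpa using ha
  · exact (norm_mul_le _ _).trans (mul_le_mul hinv ((norm_transpose_le _).trans hinv)
      (norm_nonneg _) (inv_nonneg.2 hε.le))
  · exact mul_nonneg ((abs_nonneg a).trans ha) (Real.exp_pos _).le

/-- The ellipticity that survives complex perturbation. `hWS` says that `S` is the imaginary part of
`W`, hence of the whole Jacobian. The rotation caused by the determinant and the defect caused by
`S` are estimated separately; `0.86` and `0.84` leave just enough room for both. -/
theorem coefficientMatrix_coercive {δ β a c : ℝ} (hδ0 : 0 < δ) (hδ1 : δ < 1) (hβ0 : 0 ≤ β)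
    (hβ1 : Real.exp (d * (β / δ)) ≤ 3 / 2) (hβ2 : 2 * β ≤ 0.84 * (δ - β)) (hβ3 : β < δ)
    (hc : 0 ≤ c) (ha : c ≤ a)
    {E S : Matrix (Fin d) (Fin d) ℝ} {W : Matrix (Fin d) (Fin d) ℂ}
    (hE : ‖E‖ ≤ 1 - δ) (hS : ‖S‖ ≤ β) (hW : ‖W‖ ≤ β)
    (hWS : W.map star = W - (2 * Complex.I) • complexMatrix S) (q : EuclideanSpace ℂ (Fin d)) :
    c * δ ^ d / 400 * ‖q‖ ^ 2 ≤ (⟪q, Matrix.toEuclideanCLM (n := Fin d) (𝕜 := ℂ)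
      (coefficientMatrix a (1 + (complexMatrix E + W))) q⟫_ℂ).re := by
  set T := Matrix.toEuclideanCLM (n := Fin d) (𝕜 := ℂ) with hT
  have hTnorm : ∀ M, ‖T M‖ = ‖M‖ := fun M => rfl
  set J₀ : Matrix (Fin d) (Fin d) ℂ := 1 + complexMatrix E with hJ₀
  set J : Matrix (Fin d) (Fin d) ℂ := 1 + (complexMatrix E + W) with hJ
  have hE' : ‖complexMatrix E‖ ≤ 1 - δ := (norm_complexMatrix_le E).trans hE
  obtain ⟨hu₀, hinv₀⟩ := norm_one_add_inv_le hδ0 hE'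
  have hEW : ‖complexMatrix E + W‖ ≤ 1 - (δ - β) := (norm_add_le _ _).trans (by linarith)
  obtain ⟨hu, hinv⟩ := norm_one_add_inv_le (sub_pos.2 hβ3) hEW
  rw [← hJ] at hu hinv
  rw [← hJ₀] at hu₀ hinv₀
  obtain ⟨D, hD0, hD⟩ : ∃ D : ℝ, δ ^ d ≤ D ∧ J₀.det = (D : ℂ) := by
    have h1 : J₀ = complexMatrix (1 + E) := by simp [hJ₀, complexMatrix, Matrix.map_add]
    refine ⟨(1 + E).det, ?_, by rw [h1, det_complexMatrix]⟩
    have h2 := pow_le_norm_det_one_add hδ0.le hE'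
    rw [← hJ₀, h1, det_complexMatrix, Complex.norm_real, Real.norm_eq_abs,
      abs_of_pos (det_one_add_pos (by linarith))] at h2
    exact h2
  set A := (1 + J₀⁻¹ * W).det with hA
  -- Factor `J = J₀ (1 + J₀⁻¹W)`: only the second determinant is complex.
  have hdet : J.det = D * A := by
    rw [hA, ← hD, ← Matrix.det_mul, mul_add, mul_one, ← mul_assoc, Matrix.mul_nonsing_inv _ hu₀,
      one_mul, hJ, hJ₀, add_assoc]
  have hA1 : ‖A - 1‖ ≤ 1 / 2 := by
    refine (norm_det_one_add_sub_one_le _).trans ?_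
    have h1 : ‖J₀⁻¹ * W‖ ≤ β / δ := by
      refine (norm_mul_le _ _).trans ?_
      rw [div_eq_inv_mul]
      exact mul_le_mul hinv₀ hW (norm_nonneg _) (inv_nonneg.2 hδ0.le)
    have h2 : Real.exp (d * ‖J₀⁻¹ * W‖) ≤ Real.exp (d * (β / δ)) := by gcongr
    linarith
  have hAhalf : 1 / 2 ≤ ‖A‖ := by
    have := norm_sub_norm_le 1 A
    rw [norm_one, norm_sub_rev] at this
    linarith
  -- `|A - 1| ≤ 1/2` gives `|A|² + 3/4 ≤ 2 Re A`, and `|A|² + 0.86² ≥ 2 · 0.86 |A|` with `0.86² <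
  -- 3/4`.
  have hAre : 0.86 * ‖A‖ ≤ A.re := by
    have h1 : ‖A - 1‖ ^ 2 ≤ (1 / 2) ^ 2 := by gcongr
    have h2 : ‖A‖ ^ 2 = A.re * A.re + A.im * A.im := by
      rw [Complex.sq_norm, Complex.normSq_apply]
    rw [Complex.sq_norm, Complex.normSq_apply] at h1
    simp only [Complex.sub_re, Complex.one_re, Complex.sub_im, Complex.one_im] at h1
    nlinarith [sq_nonneg (‖A‖ - 0.86)]
  -- In this variable the leading part of the form is exactly `‖p‖²`.
  set p := T (J⁻¹).transpose q with hp
  have hq : T J.transpose p = q := by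
    rw [hp, ← mul_apply_eq_comp, ← map_mul, ← Matrix.transpose_mul,
      Matrix.nonsing_inv_mul _ hu, Matrix.transpose_one, map_one, one_apply_eq_self]
  have hqp : ‖q‖ ≤ 2 * ‖p‖ := by
    rw [← hq]
    refine (ContinuousLinearMap.le_opNorm _ _).trans ?_
    gcongr
    rw [hTnorm]
    refine (norm_transpose_le _).trans ((norm_add_le _ _).trans ?_)
    have hone : ‖(1 : Matrix (Fin d) (Fin d) ℂ)‖ ≤ 1 := by
      obtain h | h := isEmpty_or_nonempty (Fin d)
      · rw [Subsingleton.elim (1 : Matrix (Fin d) (Fin d) ℂ) 0]; simp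
      · exact CStarRing.norm_one.le
    linarith
  have hconj : J.transpose.conjTranspose * J⁻¹ =
      1 - (2 * Complex.I) • (complexMatrix S * J⁻¹) := by
    have h1 : J.transpose.conjTranspose = J - (2 * Complex.I) • complexMatrix S := by
      have h2 : J.transpose.conjTranspose = 1 + (complexMatrix E + W.map star) := by
        ext i j
        obtain rfl | hij := eq_or_ne i j
        · simp [hJ]
        · simp [hJ, Matrix.one_apply_ne, hij, hij.symm]
      rw [h2, hWS, hJ]; abel
    rw [h1, sub_mul, Matrix.mul_nonsing_inv _ hu, smul_mul_assoc]
  set Z := ⟪p, T ((2 * Complex.I) • (complexMatrix S * J⁻¹)) p⟫_ℂ with hZ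
  have hZle : ‖Z‖ ≤ 0.84 * ‖p‖ ^ 2 := by
    have h1 : ‖(2 * Complex.I) • (complexMatrix S * J⁻¹)‖ ≤ 0.84 := by
      rw [norm_smul]
      have h2 : ‖complexMatrix S * J⁻¹‖ ≤ β * (δ - β)⁻¹ :=
        (norm_mul_le _ _).trans (mul_le_mul ((norm_complexMatrix_le S).trans hS) hinv
          (norm_nonneg _) hβ0)
      have h3 : 2 * (β * (δ - β)⁻¹) ≤ 0.84 := by
        rw [← mul_assoc, ← div_eq_mul_inv, div_le_iff₀ (sub_pos.2 hβ3)]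
        exact hβ2
      have h4 : ‖2 * Complex.I‖ = 2 := by simp
      rw [h4]
      linarith
    refine (norm_inner_le_norm _ _).trans ?_
    have h2 := ContinuousLinearMap.le_opNorm (T ((2 * Complex.I) • (complexMatrix S * J⁻¹))) p
    rw [hTnorm] at h2
    nlinarith [norm_nonneg p, mul_le_mul_of_nonneg_right h1 (norm_nonneg p)]
  have hval : ⟪q, T (coefficientMatrix a J) q⟫_ℂ =
      ((a * D : ℝ) : ℂ) * (A * (((‖p‖ ^ 2 : ℝ) : ℂ) - Z)) := by
    have h1 : T (coefficientMatrix a J) q = ((a : ℂ) * J.det) • T J⁻¹ p := by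
      rw [coefficientMatrix_eq, map_smul, map_mul]
      rfl
    have h2 : ⟪q, T J⁻¹ p⟫_ℂ = ((‖p‖ ^ 2 : ℝ) : ℂ) - Z := by
      conv_lhs => rw [← hq]
      rw [← ContinuousLinearMap.adjoint_inner_right, ← ContinuousLinearMap.star_eq_adjoint,
        ← map_star, Matrix.star_eq_conjTranspose, ← mul_apply_eq_comp, ← map_mul,
        hconj, map_sub, map_one, sub_apply, one_apply_eq_self,
        inner_sub_right, inner_self_eq_norm_sq_to_K]
      push_cast
      rfl
    rw [h1, inner_smul_right, h2, hdet]
    push_cast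
    ring
  rw [hval, Complex.re_ofReal_mul]
  -- The margin is `(0.86 - 0.84)‖A‖ ≥ 0.02 · 1/2`. Combined with `‖q‖ ≤ 2‖p‖` it produces the
  -- factor `1/400`.
  have hre : 0.01 * ‖p‖ ^ 2 ≤ (A * (((‖p‖ ^ 2 : ℝ) : ℂ) - Z)).re := by
    have h1 : (A * Z).re ≤ ‖A‖ * ‖Z‖ := (Complex.re_le_norm _).trans (norm_mul _ _).le
    have h2 : (A * (((‖p‖ ^ 2 : ℝ) : ℂ) - Z)).re = A.re * ‖p‖ ^ 2 - (A * Z).re := by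
      rw [mul_sub, Complex.sub_re, Complex.re_mul_ofReal]
    rw [h2]
    nlinarith [mul_le_mul_of_nonneg_right hAre (sq_nonneg ‖p‖),
      mul_le_mul_of_nonneg_left hZle (norm_nonneg A),
      mul_le_mul_of_nonneg_right hAhalf (sq_nonneg ‖p‖)]
  have hqp2 : ‖q‖ ^ 2 / 400 ≤ 0.01 * ‖p‖ ^ 2 := by
    have : ‖q‖ ^ 2 ≤ (2 * ‖p‖) ^ 2 := by gcongr
    nlinarith
  calc c * δ ^ d / 400 * ‖q‖ ^ 2 = c * δ ^ d * (‖q‖ ^ 2 / 400) := by ring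
    _ ≤ a * D * (A * (((‖p‖ ^ 2 : ℝ) : ℂ) - Z)).re := by
      refine mul_le_mul (mul_le_mul ha hD0 (by positivity) (hc.trans ha)) (hqp2.trans hre)
        (by positivity) (mul_nonneg (hc.trans ha) ((pow_pos hδ0 d).le.trans hD0))

end Pointwise

/-! ### From pointwise holomorphy to holomorphy with values in `L^∞`. -/

section LpHolomorphy

open Metric Filter Topology

theorem norm_Lp_top_le {X F : Type*} [MeasurableSpace X] {ν : Measure X}
    [NormedAddCommGroup F] {f : Lp F ⊤ ν} {C : ℝ} (hC : 0 ≤ C) (hf : ∀ᵐ x ∂ν, ‖f x‖ ≤ C) :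
    ‖f‖ ≤ C := by
  rw [Lp.norm_def, eLpNorm_exponent_top]
  exact ENNReal.toReal_le_of_le_ofReal hC (eLpNormEssSup_le_of_ae_bound hf)

variable {E F : Type*} [NormedAddCommGroup E] [NormedSpace ℂ E]
  [NormedAddCommGroup F] [NormedSpace ℂ F] [CompleteSpace F]

/-- Cauchy estimates for the derivative and for the second order Taylor remainder, at `0`. -/
theorem norm_deriv_le_and_taylor_remainder_le {φ : ℂ → F} {ρ K : ℝ}
    (hρ : 1 < ρ)
    (hd : DifferentiableOn ℂ φ (ball 0 ρ)) (hb : ∀ s ∈ ball (0 : ℂ) ρ, ‖φ s‖ ≤ K) :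
    ‖deriv φ 0‖ ≤ 2 * K / ρ ∧ ‖φ 1 - φ 0 - deriv φ 0‖ ≤ 4 * K / ρ ^ 2 := by
  have hρ0 : 0 < ρ := one_pos.trans hρ
  have h0 : (0 : ℂ) ∈ ball (0 : ℂ) ρ := mem_ball_self hρ0
  have h1 : (1 : ℂ) ∈ ball (0 : ℂ) ρ := by simpa using hρ
  have hmaps : MapsTo φ (ball 0 ρ) (closedBall (φ 0) (2 * K)) := fun s hs => by
    rw [mem_closedBall, dist_eq_norm]
    linarith [norm_sub_le (φ s) (φ 0), hb s hs, hb 0 h0]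
  have hψ : ∀ s ∈ ball (0 : ℂ) ρ, ‖dslope φ 0 s‖ ≤ 2 * K / ρ := fun s hs =>
    Complex.norm_dslope_le_div_of_mapsTo_ball hd hmaps hs
  have hψd : DifferentiableOn ℂ (dslope φ 0) (ball 0 ρ) :=
    (Complex.differentiableOn_dslope (isOpen_ball.mem_nhds h0)).2 hd
  have hψmaps : MapsTo (dslope φ 0) (ball 0 ρ) (closedBall (dslope φ 0 0) (4 * K / ρ)) :=
    fun s hs => by
      rw [mem_closedBall, dist_eq_norm]
      have h2 : 4 * K / ρ = 2 * K / ρ + 2 * K / ρ := by ring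
      linarith [norm_sub_le (dslope φ 0 s) (dslope φ 0 0), hψ s hs, hψ 0 h0]
  refine ⟨by simpa using hψ 0 h0, ?_⟩
  -- The Schwarz lemma is used a second time, on the first divided difference. The second divided
  -- difference at `1` is exactly the Taylor remainder `φ 1 - φ 0 - φ' 0`.
  have h3 := Complex.norm_dslope_le_div_of_mapsTo_ball hψd hψmaps h1
  rw [dslope_of_ne _ one_ne_zero, slope_def_module, sub_zero, inv_one, one_smul,
    dslope_of_ne _ one_ne_zero, slope_def_module, sub_zero, inv_one, one_smul, dslope_same] at h3
  rwa [div_div, ← sq] at h3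

/-- Cauchy estimates in several variables. -/
theorem norm_fderiv_le_and_taylor_remainder_le {g : E → F} {z₀ h : E} {R K : ℝ} (hR : 0 < R)
    (hd : DifferentiableOn ℂ g (ball z₀ R)) (hb : ∀ z ∈ ball z₀ R, ‖g z‖ ≤ K)
    (hh : ‖h‖ < R) :
    ‖fderiv ℂ g z₀ h‖ ≤ 2 * K / R * ‖h‖ ∧
      ‖g (z₀ + h) - g z₀ - fderiv ℂ g z₀ h‖ ≤ 4 * K / R ^ 2 * ‖h‖ ^ 2 := by
  obtain rfl | hne := eq_or_ne h 0
  · simp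
  have hpos : 0 < ‖h‖ := norm_pos_iff.2 hne
  -- Restriction to the complex line through `z₀` in direction `h`. The disc has radius `R / ‖h‖ >
  -- 1`, so `s = 1` lies inside it.
  have hmaps : MapsTo (fun s : ℂ => z₀ + s • h) (ball 0 (R / ‖h‖)) (ball z₀ R) := fun s hs => by
    rw [mem_ball_zero_iff, lt_div_iff₀ hpos] at hs
    simpa [mem_ball, dist_eq_norm, norm_smul] using hs
  have hline : ∀ s : ℂ, HasDerivAt (fun s : ℂ => z₀ + s • h) h s := fun s => by
    simpa using ((hasDerivAt_id s).smul_const h).const_add z₀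
  have hφ : DifferentiableOn ℂ (fun s : ℂ => g (z₀ + s • h)) (ball 0 (R / ‖h‖)) :=
    hd.comp (fun s _ => (hline s).differentiableAt.differentiableWithinAt) hmaps
  have hz₀ : DifferentiableAt ℂ g (z₀ + (0 : ℂ) • h) := by
    simpa using hd.differentiableAt (isOpen_ball.mem_nhds (mem_ball_self hR))
  have hderiv : deriv (fun s : ℂ => g (z₀ + s • h)) 0 = fderiv ℂ g z₀ h := by
    have := (hz₀.hasFDerivAt.comp_hasDerivAt (0 : ℂ) (hline 0)).deriv
    simpa [Function.comp_def] using this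
  obtain ⟨h1, h2⟩ := norm_deriv_le_and_taylor_remainder_le ((one_lt_div hpos).2 hh) hφ
    fun s hs => hb _ (hmaps hs)
  rw [hderiv] at h1 h2
  refine ⟨h1.trans_eq (by field_simp), ?_⟩
  simp only [one_smul, zero_smul, add_zero] at h2
  exact h2.trans_eq (by field_simp)

variable {X : Type*} [MeasurableSpace X] {ν : Measure X}

/-- A family of holomorphic functions with a uniform bound depends holomorphically on the
parameter as an element of `L^∞`. -/
theorem differentiableAt_Lp_top {g : X → E → F} {G : E → Lp F ⊤ ν} {z₀ : E} {R K : ℝ}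
    (hR : 0 < R) (hG : ∀ z ∈ ball z₀ R, G z =ᵐ[ν] fun x => g x z)
    (hd : ∀ᵐ x ∂ν, DifferentiableOn ℂ (g x) (ball z₀ R))
    (hb : ∀ᵐ x ∂ν, ∀ z ∈ ball z₀ R, ‖g x z‖ ≤ K) : DifferentiableAt ℂ G z₀ := by
  wlog hK : 0 ≤ K generalizing K
  · exact this (hb.mono fun x hx z hz => (hx z hz).trans (le_max_left K 0)) (le_max_right _ _)
  have hz₀ : z₀ ∈ ball z₀ R := mem_ball_self hR
  have hest : ∀ h : E, ‖h‖ < R → ∀ᵐ x ∂ν, ‖fderiv ℂ (g x) z₀ h‖ ≤ 2 * K / R * ‖h‖ ∧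
      ‖g x (z₀ + h) - g x z₀ - fderiv ℂ (g x) z₀ h‖ ≤ 4 * K / R ^ 2 * ‖h‖ ^ 2 := fun h hh => by
    filter_upwards [hd, hb] with x hdx hbx
    exact norm_fderiv_le_and_taylor_remainder_le hR hdx hbx hh
  -- The derivative is linear in `h`, so scaling `h` into the ball removes the size restriction.
  have hbound : ∀ h : E, ∀ᵐ x ∂ν, ‖fderiv ℂ (g x) z₀ h‖ ≤ 2 * K / R * ‖h‖ := fun h => by
    obtain ⟨t, ht0, ht⟩ : ∃ t : ℝ, 0 < t ∧ t * ‖h‖ < R := by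
      refine ⟨R / (‖h‖ + 1), by positivity, ?_⟩
      rw [div_mul_eq_mul_div, div_lt_iff₀ (by positivity)]
      nlinarith [norm_nonneg h]
    have hn : ‖(t : ℂ) • h‖ = t * ‖h‖ := by
      rw [norm_smul, Complex.norm_real, Real.norm_of_nonneg ht0.le]
    filter_upwards [hest ((t : ℂ) • h) (hn.trans_lt ht)] with x hx
    have h1 := hx.1
    rw [map_smul, norm_smul, Complex.norm_real, Real.norm_of_nonneg ht0.le, hn] at h1
    refine le_of_mul_le_mul_left (h1.trans_eq (by ring)) ht0
  -- The pointwise derivative is a limit of difference quotients of measurable functions. The shift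
  -- by `n₀` keeps every evaluation point in the ball, where `g · z` is known to be measurable.
  have hmeas : ∀ h : E, AEStronglyMeasurable (fun x => fderiv ℂ (g x) z₀ h) ν := fun h => by
    have hlim0 : Tendsto (fun n : ℕ => ((n : ℂ) + 1)⁻¹) atTop (𝓝 0) := by
      simpa using tendsto_one_div_add_atTop_nhds_zero_nat (𝕜 := ℂ)
    have hmem : ∀ᶠ n : ℕ in atTop, z₀ + ((n : ℂ) + 1)⁻¹ • h ∈ ball z₀ R := by
      have : Tendsto (fun n : ℕ => z₀ + ((n : ℂ) + 1)⁻¹ • h) atTop (𝓝 z₀) := by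
        simpa using (hlim0.smul_const h).const_add z₀
      exact this.eventually (ball_mem_nhds z₀ hR)
    obtain ⟨n₀, hn₀⟩ := eventually_atTop.1 hmem
    refine aestronglyMeasurable_of_tendsto_ae (u := atTop) (f := fun (n : ℕ) x =>
      (((n + n₀ : ℕ) : ℂ) + 1) • (g x (z₀ + (((n + n₀ : ℕ) : ℂ) + 1)⁻¹ • h) - g x z₀))
      (fun n => ?_) ?_
    · refine AEStronglyMeasurable.const_smul (AEStronglyMeasurable.sub ?_ ?_) _
      · exact (Lp.aestronglyMeasurable _).congr (hG _ (hn₀ (n + n₀) (Nat.le_add_left _ _)))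
      · exact (Lp.aestronglyMeasurable _).congr (hG _ hz₀)
    · filter_upwards [hd] with x hx
      have hfd := (hx.differentiableAt (isOpen_ball.mem_nhds hz₀)).hasFDerivAt
      refine hfd.lim h ?_
      refine tendsto_atTop_mono (f := fun n : ℕ => (n : ℝ)) (fun n => ?_)
        tendsto_natCast_atTop_atTop
      rw [← Nat.cast_add_one, RCLike.norm_natCast]
      exact_mod_cast (by omega : n ≤ n + n₀ + 1)
  have hmemLp : ∀ h : E, MemLp (fun x => fderiv ℂ (g x) z₀ h) ⊤ ν := fun h =>
    memLp_top_of_bound (hmeas h) _ (hbound h)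
  let T : E →ₗ[ℂ] Lp F ⊤ ν :=
    { toFun := fun h => (hmemLp h).toLp _
      map_add' := fun h k => by
        rw [← MemLp.toLp_add]
        exact MemLp.toLp_congr _ _ (Eventually.of_forall fun x => map_add _ _ _)
      map_smul' := fun c h => by
        rw [RingHom.id_apply, ← MemLp.toLp_const_smul]
        exact MemLp.toLp_congr _ _ (Eventually.of_forall fun x => map_smul _ _ _) }
  have hT : ∀ h, T h =ᵐ[ν] fun x => fderiv ℂ (g x) z₀ h := fun h => (hmemLp h).coeFn_toLp
  let T' : E →L[ℂ] Lp F ⊤ ν := T.mkContinuous (2 * K / R) fun h => by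
    refine norm_Lp_top_le (by positivity) ?_
    filter_upwards [hT h, hbound h] with x h1 h2
    rwa [h1]
  refine (HasFDerivAt.of_isLittleO (f' := T') ?_).differentiableAt
  -- The pointwise remainder bound is uniform in `x`, hence a bound in `L^∞`.
  have hO : (fun z => G z - G z₀ - T' (z - z₀)) =O[𝓝 z₀] fun z => ‖z - z₀‖ ^ 2 := by
    refine Asymptotics.IsBigO.of_bound (4 * K / R ^ 2) ?_
    filter_upwards [ball_mem_nhds z₀ hR] with z hz
    rw [norm_pow, norm_norm]
    refine norm_Lp_top_le (by positivity) ?_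
    have hh : ‖z - z₀‖ < R := by rwa [← dist_eq_norm]
    filter_upwards [hest _ hh, hG z hz, hG z₀ hz₀, hT (z - z₀), Lp.coeFn_sub (G z) (G z₀),
      Lp.coeFn_sub (G z - G z₀) (T' (z - z₀))] with x h1 h2 h3 h4 h5 h6
    have h7 : (T' (z - z₀) : X → F) x = fderiv ℂ (g x) z₀ (z - z₀) := h4
    rw [h6, Pi.sub_apply, h5, Pi.sub_apply, h2, h3, h7]
    simpa using h1.2
  refine hO.trans_isLittleO ?_
  have h1 : (fun z : E => ‖z - z₀‖ ^ 2) =o[𝓝 z₀] fun z => ‖z - z₀‖ ^ 1 := by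
    have h2 : Tendsto (fun z : E => ‖z - z₀‖) (𝓝 z₀) (𝓝 0) := by
      have : Tendsto (fun z : E => ‖z - z₀‖) (𝓝 z₀) (𝓝 ‖z₀ - z₀‖) :=
        (continuous_id.sub continuous_const).norm.tendsto _
      simpa using this
    exact (Asymptotics.isLittleO_pow_pow one_lt_two).comp_tendsto h2
  simpa using h1

end LpHolomorphy

/-! ### Test functions, `H¹₀` and the Poincaré inequality. -/

section SobolevZero

open scoped InnerProductSpace

variable {d : ℕ} {𝕜 : Type*} [RCLike 𝕜] {U : Set (EuclideanSpace ℝ (Fin d))}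

theorem IsTestFunction.differentiable {φ : EuclideanSpace ℝ (Fin d) → 𝕜}
    (hφ : IsTestFunction U φ) : Differentiable ℝ φ :=
  hφ.1.differentiable (by simp)

theorem IsTestFunction.continuous_fderiv {φ : EuclideanSpace ℝ (Fin d) → 𝕜}
    (hφ : IsTestFunction U φ) : Continuous (fderiv ℝ φ) :=
  hφ.1.continuous_fderiv (by simp)

theorem IsTestFunction.continuous_classicalGradient {φ : EuclideanSpace ℝ (Fin d) → 𝕜}
    (hφ : IsTestFunction U φ) : Continuous (classicalGradient φ) := by
  have h := hφ.continuous_fderiv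
  refine (PiLp.continuous_toLp 2 _).comp (continuous_pi fun i => ?_)
  fun_prop

theorem classicalGradient_eq_zero {φ : EuclideanSpace ℝ (Fin d) → 𝕜}
    {x : EuclideanSpace ℝ (Fin d)} (hx : x ∉ tsupport φ) : classicalGradient φ x = 0 := by
  have h : fderiv ℝ φ x = 0 := by
    by_contra h
    exact hx (support_fderiv_subset ℝ (Function.mem_support.2 h))
  ext i
  simp [classicalGradient, h]

theorem IsTestFunction.hasCompactSupport_classicalGradient {φ : EuclideanSpace ℝ (Fin d) → 𝕜}
    (hφ : IsTestFunction U φ) : HasCompactSupport (classicalGradient φ) :=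
  HasCompactSupport.intro hφ.2.1 fun _ => classicalGradient_eq_zero

theorem IsTestFunction.memLp {φ : EuclideanSpace ℝ (Fin d) → 𝕜} (hφ : IsTestFunction U φ) :
    MemLp φ 2 (volume.restrict U) :=
  (hφ.1.continuous.memLp_of_hasCompactSupport hφ.2.1).restrict U

theorem IsTestFunction.memLp_classicalGradient {φ : EuclideanSpace ℝ (Fin d) → 𝕜}
    (hφ : IsTestFunction U φ) : MemLp (classicalGradient φ) 2 (volume.restrict U) :=
  (hφ.continuous_classicalGradient.memLp_of_hasCompactSupport
    hφ.hasCompactSupport_classicalGradient).restrict U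

theorem IsTestFunction.add {φ ψ : EuclideanSpace ℝ (Fin d) → 𝕜}
    (hφ : IsTestFunction U φ) (hψ : IsTestFunction U ψ) : IsTestFunction U (φ + ψ) :=
  ⟨hφ.1.add hψ.1, hφ.2.1.add hψ.2.1,
    (tsupport_add φ ψ).trans (union_subset hφ.2.2 hψ.2.2)⟩

theorem IsTestFunction.const_smul {φ : EuclideanSpace ℝ (Fin d) → 𝕜}
    (hφ : IsTestFunction U φ) (c : 𝕜) : IsTestFunction U (c • φ) :=
  have h : tsupport (c • φ) ⊆ tsupport φ :=
    closure_mono (Function.support_const_smul_subset c φ)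
  ⟨hφ.1.const_smul c, hφ.2.1.of_isClosed_subset (isClosed_tsupport _) h, h.trans hφ.2.2⟩

theorem classicalGradient_add {φ ψ : EuclideanSpace ℝ (Fin d) → 𝕜}
    (hφ : IsTestFunction U φ) (hψ : IsTestFunction U ψ) :
    classicalGradient (φ + ψ) = classicalGradient φ + classicalGradient ψ := by
  ext x i
  simp [classicalGradient, fderiv_add (hφ.differentiable x) (hψ.differentiable x)]

theorem classicalGradient_const_smul {φ : EuclideanSpace ℝ (Fin d) → 𝕜}
    (hφ : IsTestFunction U φ) (c : 𝕜) :
    classicalGradient (c • φ) = c • classicalGradient φ := by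
  ext x i
  simp [classicalGradient, fderiv_const_smul (hφ.differentiable x) c]

theorem mem_testPairs_of_mem_span {p : L2Pair 𝕜 U} (hp : p ∈ Submodule.span 𝕜 (testPairs 𝕜 U)) :
    p ∈ testPairs 𝕜 U := by
  induction hp using Submodule.span_induction with
  | mem p hp => exact hp
  | zero =>
    refine ⟨0, ⟨contDiff_const, HasCompactSupport.zero, by simp [tsupport]⟩, ?_, ?_⟩
    · exact Lp.coeFn_zero _ _ _
    · have : classicalGradient (0 : EuclideanSpace ℝ (Fin d) → 𝕜) = 0 := by
        ext x i; simp [classicalGradient]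
      rw [this]
      exact Lp.coeFn_zero _ _ _
  | add p q _ _ hp hq =>
    obtain ⟨φ, hφ, h1, h2⟩ := hp
    obtain ⟨ψ, hψ, h3, h4⟩ := hq
    refine ⟨φ + ψ, hφ.add hψ, (Lp.coeFn_add _ _).trans (h1.add h3), ?_⟩
    rw [classicalGradient_add hφ hψ]
    exact (Lp.coeFn_add _ _).trans (h2.add h4)
  | smul c p _ hp =>
    obtain ⟨φ, hφ, h1, h2⟩ := hp
    refine ⟨c • φ, hφ.const_smul c, (Lp.coeFn_smul _ _).trans (h1.const_smul c), ?_⟩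
    rw [classicalGradient_const_smul hφ]
    exact (Lp.coeFn_smul _ _).trans (h2.const_smul c)

/-- The test pairs already form a subspace, so the span is harmless, and closed conditions on `H¹₀`
need only be checked on test functions. -/
theorem mem_H10_iff {p : L2Pair 𝕜 U} : p ∈ H10 𝕜 U ↔ p ∈ closure (testPairs 𝕜 U) := by
  have h : ((Submodule.span 𝕜 (testPairs 𝕜 U) : Submodule 𝕜 (L2Pair 𝕜 U)) : Set (L2Pair 𝕜 U)) =
      testPairs 𝕜 U :=
    Subset.antisymm (fun _ hp => mem_testPairs_of_mem_span hp) Submodule.subset_span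
  rw [← SetLike.mem_coe, Submodule.topologicalClosure_coe, h]

/-- The pair `(φ, ∇φ)` of a test function, as an element of `H¹₀`. -/
theorem IsTestFunction.exists_H10 {φ : EuclideanSpace ℝ (Fin d) → 𝕜} (hφ : IsTestFunction U φ) :
    ∃ u : H10 𝕜 U, h10Fun u =ᵐ[volume.restrict U] φ ∧
      h10Grad u =ᵐ[volume.restrict U] classicalGradient φ := by
  let p : L2Pair 𝕜 U := WithLp.toLp 2 (hφ.memLp.toLp φ, hφ.memLp_classicalGradient.toLp _)
  have h1 : p.fst =ᵐ[volume.restrict U] φ := hφ.memLp.coeFn_toLp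
  have h2 : p.snd =ᵐ[volume.restrict U] classicalGradient φ :=
    hφ.memLp_classicalGradient.coeFn_toLp
  exact ⟨⟨p, mem_H10_iff.2 (subset_closure ⟨φ, hφ, h1, h2⟩)⟩, h1, h2⟩

/-- **Poincaré inequality** for test functions. -/
theorem IsTestFunction.poincare {φ : EuclideanSpace ℝ (Fin d) → 𝕜} (hφ : IsTestFunction U φ)
    (i : Fin d) {M : ℝ} (hM : ∀ x ∈ U, |x i| ≤ M) :
    ∫ x, ‖φ x‖ ^ 2 ≤ 4 * M ^ 2 * ∫ x, ‖classicalGradient φ x‖ ^ 2 := by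
  set e : EuclideanSpace ℝ (Fin d) := EuclideanSpace.single i 1 with he
  have hφd := hφ.differentiable
  have hφc := hφ.1.continuous
  have hDφc := hφ.continuous_fderiv
  have hcg := hφ.continuous_classicalGradient
  have hzero : ∀ x ∉ tsupport φ, φ x = 0 := fun x hx => image_eq_zero_of_notMem_tsupport hx
  have hint1 : Integrable (fun x => ‖φ x‖ ^ 2) :=
    Continuous.integrable_of_hasCompactSupport (by fun_prop)
      (HasCompactSupport.intro hφ.2.1 fun x hx => by simp [hzero x hx])
  have hint2 : Integrable (fun x => ‖classicalGradient φ x‖ ^ 2) :=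
    Continuous.integrable_of_hasCompactSupport (by fun_prop)
      (HasCompactSupport.intro hφ.2.1 fun x hx => by simp [classicalGradient_eq_zero hx])
  set g : EuclideanSpace ℝ (Fin d) → 𝕜 := fun x => ⟪φ x, φ x⟫_𝕜 with hg
  have hgd : Differentiable ℝ g := hφd.inner 𝕜 hφd
  have hg' : ∀ x, fderiv ℝ g x e = ⟪φ x, fderiv ℝ φ x e⟫_𝕜 + ⟪fderiv ℝ φ x e, φ x⟫_𝕜 :=
    fun x => fderiv_inner_apply 𝕜 (hφd x) (hφd x) e
  have hx : ∀ x : EuclideanSpace ℝ (Fin d),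
      HasFDerivAt (fun x : EuclideanSpace ℝ (Fin d) => x i)
        (EuclideanSpace.proj i : EuclideanSpace ℝ (Fin d) →L[ℝ] ℝ) x := fun x =>
    (EuclideanSpace.proj i : EuclideanSpace ℝ (Fin d) →L[ℝ] ℝ).hasFDerivAt
  have hx' : ∀ x, fderiv ℝ (fun x : EuclideanSpace ℝ (Fin d) => x i) x e = 1 := fun x => by
    rw [(hx x).fderiv]; simp [he]
  have hgc : Continuous g := by fun_prop
  have hfg'c : Continuous fun x : EuclideanSpace ℝ (Fin d) => x i • fderiv ℝ g x e := by
    simp only [hg']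
    fun_prop
  -- Since `∂ᵢxᵢ = 1`, integration by parts gives `∫|φ|² = -∫ xᵢ ∂ᵢ|φ|²`.
  have hparts := integral_smul_fderiv_eq_neg_fderiv_smul_of_integrable (μ := volume)
    (f := fun x : EuclideanSpace ℝ (Fin d) => x i) (g := g) (v := e)
    (by
      simp only [hx', one_smul]
      exact hgc.integrable_of_hasCompactSupport
        (HasCompactSupport.intro hφ.2.1 fun x hx => by simp [hg, hzero x hx]))
    (hfg'c.integrable_of_hasCompactSupport
      (HasCompactSupport.intro hφ.2.1 fun x hx => by simp [hg', hzero x hx]))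
    (Continuous.integrable_of_hasCompactSupport (by fun_prop)
      (HasCompactSupport.intro hφ.2.1 fun x hx => by simp [hg, hzero x hx]))
    (fun x _ => (hx x).differentiableAt) (fun x _ => hgd x)
  simp only [hx', one_smul] at hparts
  have hgint : ∫ x, g x = ((∫ x, ‖φ x‖ ^ 2 : ℝ) : 𝕜) := by
    rw [← integral_ofReal]
    refine integral_congr_ae (.of_forall fun x => ?_)
    simp [hg, inner_self_eq_norm_sq_to_K]
  have hnonneg : 0 ≤ ∫ x, ‖φ x‖ ^ 2 := integral_nonneg fun x => by positivity
  -- Young's inequality `2M|φ||∇φ| ≤ |φ|²/2 + 2M²|∇φ|²`. The first term is absorbed on the left,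
  -- which turns `2M²` into `4M²`.
  have hle : ∫ x, ‖φ x‖ ^ 2 ≤ ∫ x, (1 / 2 * ‖φ x‖ ^ 2 + 2 * M ^ 2 * ‖classicalGradient φ x‖ ^ 2) := by
    calc ∫ x, ‖φ x‖ ^ 2 = ‖∫ x, g x‖ := by
          rw [hgint, RCLike.norm_ofReal, abs_of_nonneg hnonneg]
      _ = ‖∫ x, x i • fderiv ℝ g x e‖ := by rw [hparts, norm_neg]
      _ ≤ _ := by
        refine norm_integral_le_of_norm_le ((hint1.const_mul _).add (hint2.const_mul _))
          (.of_forall fun x => ?_)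
        by_cases hxs : x ∈ tsupport φ
        · have h1 : ‖fderiv ℝ φ x e‖ ≤ ‖classicalGradient φ x‖ :=
            PiLp.norm_apply_le (classicalGradient φ x) i
          have h2 : ‖fderiv ℝ g x e‖ ≤ 2 * (‖φ x‖ * ‖classicalGradient φ x‖) := by
            rw [hg']
            refine (norm_add_le _ _).trans ?_
            have h3 := norm_inner_le_norm (𝕜 := 𝕜) (φ x) (fderiv ℝ φ x e)
            have h4 := norm_inner_le_norm (𝕜 := 𝕜) (fderiv ℝ φ x e) (φ x)
            nlinarith [mul_le_mul_of_nonneg_left h1 (norm_nonneg (φ x))]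
          rw [norm_smul, Real.norm_eq_abs]
          have h5 := mul_le_mul (hM x (hφ.2.2 hxs)) h2 (norm_nonneg _)
            ((abs_nonneg _).trans (hM x (hφ.2.2 hxs)))
          nlinarith [sq_nonneg (‖φ x‖ - 2 * M * ‖classicalGradient φ x‖)]
        · rw [hg', hzero x hxs]
          simp only [inner_zero_left, inner_zero_right, add_zero, smul_zero, norm_zero]
          positivity
  rw [integral_add (hint1.const_mul _) (hint2.const_mul _), integral_const_mul,
    integral_const_mul] at hle
  linarith

theorem norm_sq_eq_integral_norm_sq {E : Type*} [NormedAddCommGroup E] [InnerProductSpace 𝕜 E]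
    {X : Type*} [MeasurableSpace X] {ν : Measure X} (f : Lp E 2 ν) :
    ‖f‖ ^ 2 = ∫ x, ‖f x‖ ^ 2 ∂ν := by
  have h : ((‖f‖ ^ 2 : ℝ) : 𝕜) = ((∫ x, ‖f x‖ ^ 2 ∂ν : ℝ) : 𝕜) := by
    rw [← integral_ofReal, RCLike.ofReal_pow, ← inner_self_eq_norm_sq_to_K (𝕜 := 𝕜) f, L2.inner_def]
    refine integral_congr_ae (.of_forall fun x => ?_)
    simp [inner_self_eq_norm_sq_to_K]
  exact_mod_cast h

/-- **Poincaré inequality** in `H¹₀(U)` for bounded `U`. -/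
theorem exists_poincare (hd : 1 ≤ d) (hU : Bornology.IsBounded U) :
    ∃ C : ℝ, 0 < C ∧ ∀ u : H10 𝕜 U, ‖u‖ ^ 2 ≤ C * ‖(u : L2Pair 𝕜 U).snd‖ ^ 2 := by
  obtain ⟨M, hM⟩ := hU.exists_norm_le
  refine ⟨4 * M ^ 2 + 1, by positivity, fun u => ?_⟩
  have hclosed : IsClosed {p : L2Pair 𝕜 U | ‖p.fst‖ ^ 2 ≤ 4 * M ^ 2 * ‖p.snd‖ ^ 2} := by
    refine isClosed_le ?_ ?_
    · exact (WithLp.continuous_fst _ _ _).norm.pow 2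
    · exact continuous_const.mul ((WithLp.continuous_snd _ _ _).norm.pow 2)
  have hmem : (u : L2Pair 𝕜 U) ∈ {p : L2Pair 𝕜 U | ‖p.fst‖ ^ 2 ≤ 4 * M ^ 2 * ‖p.snd‖ ^ 2} := by
    refine closure_minimal ?_ hclosed (mem_H10_iff.1 u.2)
    rintro p ⟨φ, hφ, h1, h2⟩
    have h3 := hφ.poincare ⟨0, hd⟩ fun x hx =>
      (PiLp.norm_apply_le x ⟨0, hd⟩).trans (hM x hx)
    have h4 : ∫ x in U, ‖p.fst x‖ ^ 2 = ∫ x, ‖φ x‖ ^ 2 :=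
      (integral_congr_ae (h1.fun_comp fun t => ‖t‖ ^ 2)).trans
        (setIntegral_eq_integral_of_forall_compl_eq_zero fun x hx => by
          simp [image_eq_zero_of_notMem_tsupport fun h => hx (hφ.2.2 h)])
    have h5 : ∫ x in U, ‖p.snd x‖ ^ 2 = ∫ x, ‖classicalGradient φ x‖ ^ 2 :=
      (integral_congr_ae (h2.fun_comp fun t => ‖t‖ ^ 2)).trans
        (setIntegral_eq_integral_of_forall_compl_eq_zero fun x hx => by
          simp [classicalGradient_eq_zero fun h => hx (hφ.2.2 h)])
    rw [mem_ofPred_eq, norm_sq_eq_integral_norm_sq (𝕜 := 𝕜), norm_sq_eq_integral_norm_sq (𝕜 := 𝕜),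
      h4, h5]
    exact h3
  have hnorm : ‖u‖ ^ 2 = ‖(u : L2Pair 𝕜 U).fst‖ ^ 2 + ‖(u : L2Pair 𝕜 U).snd‖ ^ 2 :=
    WithLp.prod_norm_sq_eq_of_L2 _
  rw [hnorm]
  have : ‖(u : L2Pair 𝕜 U).fst‖ ^ 2 ≤ 4 * M ^ 2 * ‖(u : L2Pair 𝕜 U).snd‖ ^ 2 := hmem
  linarith

end SobolevZero

/-! ### Passage between real and complex `H¹₀`. -/

section Complexification

open scoped InnerProductSpace

variable {d : ℕ} {U : Set (EuclideanSpace ℝ (Fin d))}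

/-- The inclusion `ℝ^d → ℂ^d`. -/
noncomputable def complexVector :
    EuclideanSpace ℝ (Fin d) →L[ℝ] EuclideanSpace ℂ (Fin d) :=
  LinearMap.toContinuousLinearMap
    { toFun := fun q => WithLp.toLp 2 fun i => (q i : ℂ)
      map_add' := fun p q => by ext i; simp
      map_smul' := fun c q => by ext i; simp }

@[simp]
theorem complexVector_apply (q : EuclideanSpace ℝ (Fin d)) (i : Fin d) :
    complexVector q i = (q i : ℂ) := rfl

theorem inner_complexVector (p q : EuclideanSpace ℝ (Fin d)) :
    ⟪complexVector p, complexVector q⟫_ℂ = ((⟪p, q⟫_ℝ : ℝ) : ℂ) := by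
  simp [PiLp.inner_apply]

theorem norm_complexVector (q : EuclideanSpace ℝ (Fin d)) : ‖complexVector q‖ = ‖q‖ := by
  simp [EuclideanSpace.norm_eq]

/-- The inclusion `L²(U; ℝ) × L²(U; ℝ^d) → L²(U; ℂ) × L²(U; ℂ^d)`. -/
noncomputable def complexPair (p : L2Pair ℝ U) : L2Pair ℂ U :=
  WithLp.toLp 2 (Complex.ofRealCLM.compLp p.fst, complexVector.compLp p.snd)

theorem continuous_complexPair : Continuous (complexPair (U := U)) := by
  refine (WithLp.prod_continuous_toLp _ _ _).comp (Continuous.prodMk ?_ ?_)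
  · exact (Complex.ofRealCLM.compLpL 2 (volume.restrict U)).continuous.comp
      (WithLp.continuous_fst _ _ _)
  · exact (complexVector.compLpL 2 (volume.restrict U)).continuous.comp
      (WithLp.continuous_snd _ _ _)

theorem complexPair_fst (p : L2Pair ℝ U) :
    (complexPair p).fst =ᵐ[volume.restrict U] fun x => ((p.fst x : ℝ) : ℂ) :=
  Complex.ofRealCLM.coeFn_compLp _

theorem complexPair_snd (p : L2Pair ℝ U) :
    (complexPair p).snd =ᵐ[volume.restrict U] fun x => complexVector (p.snd x) :=
  complexVector.coeFn_compLp _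

/-- Used with the inclusion `ℝ → ℂ` to complexify, and with `re` and `im` to split a complex test
function into real ones. -/
theorem IsTestFunction.clm_comp {𝕜 𝕜' : Type*} [RCLike 𝕜] [RCLike 𝕜']
    {φ : EuclideanSpace ℝ (Fin d) → 𝕜} (hφ : IsTestFunction U φ) (L : 𝕜 →L[ℝ] 𝕜') :
    IsTestFunction U (fun x => L (φ x)) ∧
      ∀ x i, classicalGradient (fun x => L (φ x)) x i = L (classicalGradient φ x i) := by
  have h : tsupport (fun x => L (φ x)) ⊆ tsupport φ :=
    closure_mono fun x hx h0 => hx (by simp [h0])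
  refine ⟨⟨L.contDiff.comp hφ.1, hφ.2.1.of_isClosed_subset (isClosed_tsupport _) h,
    h.trans hφ.2.2⟩, fun x i => ?_⟩
  have h1 : HasFDerivAt (fun x => L (φ x)) (L.comp (fderiv ℝ φ x)) x :=
    L.hasFDerivAt.comp x (hφ.differentiable x).hasFDerivAt
  simp [classicalGradient, h1.fderiv]

theorem complexPair_mem_H10 {p : L2Pair ℝ U} (hp : p ∈ H10 ℝ U) : complexPair p ∈ H10 ℂ U := by
  rw [mem_H10_iff] at hp ⊢
  refine map_mem_closure continuous_complexPair hp ?_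
  rintro p ⟨φ, hφ, h1, h2⟩
  obtain ⟨h3, h4⟩ := hφ.clm_comp Complex.ofRealCLM
  refine ⟨_, h3, ?_, ?_⟩
  · filter_upwards [h1, complexPair_fst p] with x hx1 hx2
    rw [hx2, hx1]
    rfl
  · filter_upwards [h2, complexPair_snd p] with x hx1 hx2
    rw [hx2, hx1]
    ext i
    rw [h4]
    rfl

theorem exists_complexification (u : H10 ℝ U) : ∃ ψ : H10 ℂ U, IsComplexificationOf ψ u := by
  refine ⟨⟨complexPair u, complexPair_mem_H10 u.2⟩, complexPair_fst _, ?_⟩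
  filter_upwards [complexPair_snd (u : L2Pair ℝ U)] with x hx i
  exact congrArg (fun q : EuclideanSpace ℂ (Fin d) => q i) hx

theorem IsComplexificationOf.grad_ae {ψ : H10 ℂ U} {u : H10 ℝ U} (h : IsComplexificationOf ψ u) :
    h10Grad ψ =ᵐ[volume.restrict U] fun x => complexVector (h10Grad u x) := by
  filter_upwards [h.2] with x hx
  ext i
  exact hx i

/-- A complex linear relation that holds for all real elements of `H¹₀` holds for all elements. -/
theorem eq_zero_of_forall_complexification {ξ : H10 ℂ U}
    (h : ∀ (ψ : H10 ℂ U) (u : H10 ℝ U), IsComplexificationOf ψ u → ⟪ψ, ξ⟫_ℂ = 0) : ξ = 0 := by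
  have hclosed : IsClosed {p : L2Pair ℂ U | ⟪p, (ξ : L2Pair ℂ U)⟫_ℂ = 0} :=
    isClosed_eq (by fun_prop) continuous_const
  have hall : ∀ p ∈ H10 ℂ U, ⟪p, (ξ : L2Pair ℂ U)⟫_ℂ = 0 := fun p hp => by
    refine closure_minimal ?_ hclosed (mem_H10_iff.1 hp)
    rintro p ⟨φ, hφ, h1, h2⟩
    obtain ⟨hre, hre'⟩ := hφ.clm_comp Complex.reCLM
    obtain ⟨him, him'⟩ := hφ.clm_comp Complex.imCLM
    obtain ⟨u, hu1, hu2⟩ := hre.exists_H10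
    obtain ⟨v, hv1, hv2⟩ := him.exists_H10
    obtain ⟨ψ, hψ⟩ := exists_complexification u
    obtain ⟨χ, hχ⟩ := exists_complexification v
    have hp : p = (ψ : L2Pair ℂ U) + Complex.I • (χ : L2Pair ℂ U) := by
      have e1 : p.fst = (ψ : L2Pair ℂ U).fst + Complex.I • (χ : L2Pair ℂ U).fst := by
        refine Lp.ext ?_
        filter_upwards [h1, hu1, hv1, hψ.1, hχ.1,
          Lp.coeFn_add (ψ : L2Pair ℂ U).fst (Complex.I • (χ : L2Pair ℂ U).fst),
          Lp.coeFn_smul Complex.I (χ : L2Pair ℂ U).fst] with x a1 a2 a3 a4 a5 a6 a7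
        rw [h10Fun, a2] at a4
        rw [h10Fun, a3] at a5
        rw [a6, Pi.add_apply, a7, Pi.smul_apply, a1, a4, a5, smul_eq_mul, mul_comm]
        exact (Complex.re_add_im _).symm
      have e2 : p.snd = (ψ : L2Pair ℂ U).snd + Complex.I • (χ : L2Pair ℂ U).snd := by
        refine Lp.ext ?_
        filter_upwards [h2, hu2, hv2, hψ.2, hχ.2,
          Lp.coeFn_add (ψ : L2Pair ℂ U).snd (Complex.I • (χ : L2Pair ℂ U).snd),
          Lp.coeFn_smul Complex.I (χ : L2Pair ℂ U).snd] with x a1 a2 a3 a4 a5 a6 a7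
        rw [a6, Pi.add_apply, a7, Pi.smul_apply, a1]
        ext i
        have a8 := a4 i
        have a9 := a5 i
        rw [a2, hre', h10Grad] at a8
        rw [a3, him', h10Grad] at a9
        rw [PiLp.add_apply, PiLp.smul_apply, a8, a9, smul_eq_mul, mul_comm]
        exact (Complex.re_add_im _).symm
      exact (WithLp.ofLp_injective 2) (Prod.ext e1 e2)
    have h3 : ⟪(ψ : L2Pair ℂ U), (ξ : L2Pair ℂ U)⟫_ℂ = 0 := h ψ u hψ
    have h4 : ⟪(χ : L2Pair ℂ U), (ξ : L2Pair ℂ U)⟫_ℂ = 0 := h χ v hχ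
    rw [mem_ofPred_eq, hp, inner_add_left, inner_smul_left, h3, h4, mul_zero, add_zero]
  exact inner_self_eq_zero.1 (hall ξ ξ.2)

end Complexification

/-! ### The weak formulation as an operator equation on `H¹₀`. -/

section WeakFormulation

open scoped InnerProductSpace

variable {d : ℕ} {𝕜 : Type*} [RCLike 𝕜] {U : Set (EuclideanSpace ℝ (Fin d))}

variable (𝕜 U) in
/-- The inclusion `H¹₀(U) → L²(U)`. -/
noncomputable def h10FunL : H10 𝕜 U →L[𝕜] Lp 𝕜 2 (volume.restrict U) :=
  (WithLp.fstL 2 𝕜 _ _).comp (H10 𝕜 U).subtypeL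

variable (𝕜 U) in
/-- The weak gradient as a bounded operator `H¹₀(U) → L²(U)^d`. -/
noncomputable def h10GradL :
    H10 𝕜 U →L[𝕜] Lp (EuclideanSpace 𝕜 (Fin d)) 2 (volume.restrict U) :=
  (WithLp.sndL 2 𝕜 _ _).comp (H10 𝕜 U).subtypeL

variable (𝕜 U) in
/-- Multiplication of a square integrable vector field by a bounded matrix field. -/
noncomputable def mulField :
    Lp (EuclideanSpace 𝕜 (Fin d) →L[𝕜] EuclideanSpace 𝕜 (Fin d)) ⊤ (volume.restrict U) →L[𝕜]
      Lp (EuclideanSpace 𝕜 (Fin d)) 2 (volume.restrict U) →L[𝕜]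
        Lp (EuclideanSpace 𝕜 (Fin d)) 2 (volume.restrict U) :=
  (ContinuousLinearMap.id 𝕜 (EuclideanSpace 𝕜 (Fin d) →L[𝕜] EuclideanSpace 𝕜 (Fin d))).holderL
    (volume.restrict U) ⊤ 2 2

theorem mulField_ae
    (G : Lp (EuclideanSpace 𝕜 (Fin d) →L[𝕜] EuclideanSpace 𝕜 (Fin d)) ⊤ (volume.restrict U))
    (q : Lp (EuclideanSpace 𝕜 (Fin d)) 2 (volume.restrict U)) :
    mulField 𝕜 U G q =ᵐ[volume.restrict U] fun x => G x (q x) :=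
  (ContinuousLinearMap.id 𝕜
    (EuclideanSpace 𝕜 (Fin d) →L[𝕜] EuclideanSpace 𝕜 (Fin d))).coeFn_holder G q

/-- The operator of the sesquilinear form `(u, φ) ↦ ∫ ⟪∇φ, G ∇u⟫` on `H¹₀(U)`. -/
noncomputable def stiffness
    (G : Lp (EuclideanSpace 𝕜 (Fin d) →L[𝕜] EuclideanSpace 𝕜 (Fin d)) ⊤ (volume.restrict U)) :
    H10 𝕜 U →L[𝕜] H10 𝕜 U :=
  (h10GradL 𝕜 U).adjoint ∘L (mulField 𝕜 U G ∘L h10GradL 𝕜 U)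

/-- The functional `φ ↦ ∫ ⟪φ, F⟫ - ∫ ⟪∇φ, G q⟫` on `H¹₀(U)`. -/
noncomputable def load
    (G : Lp (EuclideanSpace 𝕜 (Fin d) →L[𝕜] EuclideanSpace 𝕜 (Fin d)) ⊤ (volume.restrict U))
    (F : Lp 𝕜 2 (volume.restrict U))
    (q : Lp (EuclideanSpace 𝕜 (Fin d)) 2 (volume.restrict U)) : H10 𝕜 U :=
  (h10FunL 𝕜 U).adjoint F - (h10GradL 𝕜 U).adjoint (mulField 𝕜 U G q)

theorem inner_stiffness
    (G : Lp (EuclideanSpace 𝕜 (Fin d) →L[𝕜] EuclideanSpace 𝕜 (Fin d)) ⊤ (volume.restrict U))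
    (u φ : H10 𝕜 U) :
    ⟪φ, stiffness G u⟫_𝕜 = ∫ x in U, ⟪h10Grad φ x, G x (h10Grad u x)⟫_𝕜 := by
  rw [stiffness, ContinuousLinearMap.comp_apply, ContinuousLinearMap.adjoint_inner_right,
    L2.inner_def]
  refine integral_congr_ae ?_
  filter_upwards [mulField_ae G (h10GradL 𝕜 U u)] with x hx
  rw [ContinuousLinearMap.comp_apply, hx]
  rfl

theorem inner_load
    (G : Lp (EuclideanSpace 𝕜 (Fin d) →L[𝕜] EuclideanSpace 𝕜 (Fin d)) ⊤ (volume.restrict U))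
    (F : Lp 𝕜 2 (volume.restrict U))
    (q : Lp (EuclideanSpace 𝕜 (Fin d)) 2 (volume.restrict U)) (φ : H10 𝕜 U) :
    ⟪φ, load G F q⟫_𝕜 = (∫ x in U, ⟪h10Fun φ x, F x⟫_𝕜) -
      ∫ x in U, ⟪h10Grad φ x, G x (q x)⟫_𝕜 := by
  have h1 : ⟪φ, (h10FunL 𝕜 U).adjoint F⟫_𝕜 = ⟪h10FunL 𝕜 U φ, F⟫_𝕜 :=
    ContinuousLinearMap.adjoint_inner_right _ _ _
  have h2 : ⟪φ, (h10GradL 𝕜 U).adjoint (mulField 𝕜 U G q)⟫_𝕜 =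
      ⟪h10GradL 𝕜 U φ, mulField 𝕜 U G q⟫_𝕜 := ContinuousLinearMap.adjoint_inner_right _ _ _
  have h3 : ⟪h10FunL 𝕜 U φ, F⟫_𝕜 = ∫ x in U, ⟪h10Fun φ x, F x⟫_𝕜 := L2.inner_def _ _
  have h4 : ⟪h10GradL 𝕜 U φ, mulField 𝕜 U G q⟫_𝕜 =
      ∫ x in U, ⟪h10Grad φ x, mulField 𝕜 U G q x⟫_𝕜 := L2.inner_def _ _
  have h5 : ∫ x in U, ⟪h10Grad φ x, mulField 𝕜 U G q x⟫_𝕜 =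
      ∫ x in U, ⟪h10Grad φ x, G x (q x)⟫_𝕜 :=
    integral_congr_ae ((mulField_ae G q).mono fun x hx => by simp only [hx])
  exact (inner_sub_right _ _ _).trans
    (congrArg₂ (· - ·) (h1.trans h3) (h2.trans (h4.trans h5)))

/-- Lax–Milgram. The form controls only the gradient; the Poincaré constant `C` upgrades this to
coercivity in the full norm with constant `c / C`. -/
theorem isUnit_stiffness (hd : 1 ≤ d) (hU : Bornology.IsBounded U)
    {G : Lp (EuclideanSpace 𝕜 (Fin d) →L[𝕜] EuclideanSpace 𝕜 (Fin d)) ⊤ (volume.restrict U)}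
    {c : ℝ} (hc : 0 < c)
    (hG : ∀ᵐ x ∂volume.restrict U, ∀ q, c * ‖q‖ ^ 2 ≤ RCLike.re ⟪q, G x q⟫_𝕜) :
    IsUnit (stiffness G) := by
  obtain ⟨C, hC, hP⟩ := exists_poincare (𝕜 := 𝕜) hd hU
  refine ContinuousLinearMap.isUnit_of_forall_le_norm_inner_map _ (c := (c / C).toNNReal)
    (Real.toNNReal_pos.2 (div_pos hc hC)) fun u => ?_
  rw [Real.coe_toNNReal _ (div_pos hc hC).le]
  have hint : Integrable (fun x => ⟪h10Grad u x, G x (h10Grad u x)⟫_𝕜) (volume.restrict U) := by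
    refine (L2.integrable_inner (𝕜 := 𝕜) (h10GradL 𝕜 U u) (mulField 𝕜 U G (h10GradL 𝕜 U u))).congr ?_
    filter_upwards [mulField_ae G (h10GradL 𝕜 U u)] with x hx
    rw [hx]
    rfl
  have hint2 : Integrable (fun x => ‖h10Grad u x‖ ^ 2) (volume.restrict U) :=
    (Lp.memLp (u : L2Pair 𝕜 U).snd).integrable_norm_pow (by norm_num)
  have h1 : c * ‖(u : L2Pair 𝕜 U).snd‖ ^ 2 ≤ RCLike.re ⟪u, stiffness G u⟫_𝕜 := by
    rw [inner_stiffness, ← integral_re hint, norm_sq_eq_integral_norm_sq (𝕜 := 𝕜),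
      ← integral_const_mul]
    refine integral_mono_ae (hint2.const_mul c) hint.re ?_
    filter_upwards [hG] with x hx
    exact hx _
  have h2 : RCLike.re ⟪u, stiffness G u⟫_𝕜 ≤ ‖⟪stiffness G u, u⟫_𝕜‖ := by
    rw [norm_inner_symm]
    exact RCLike.re_le_norm _
  refine le_trans ?_ (h1.trans h2)
  have h3 := hP u
  rw [mul_div_assoc', div_le_iff₀ hC]
  nlinarith

/-- The complexification of a real weak solution is a complex weak solution. -/
theorem stiffness_eq_load_of_isComplexificationOf
    {G : Lp (EuclideanSpace ℝ (Fin d) →L[ℝ] EuclideanSpace ℝ (Fin d)) ⊤ (volume.restrict U)}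
    {F : Lp ℝ 2 (volume.restrict U)}
    {q : Lp (EuclideanSpace ℝ (Fin d)) 2 (volume.restrict U)}
    {G' : Lp (EuclideanSpace ℂ (Fin d) →L[ℂ] EuclideanSpace ℂ (Fin d)) ⊤ (volume.restrict U)}
    {F' : Lp ℂ 2 (volume.restrict U)}
    {q' : Lp (EuclideanSpace ℂ (Fin d)) 2 (volume.restrict U)}
    (hG : ∀ᵐ x ∂volume.restrict U, ∀ p, G' x (complexVector p) = complexVector (G x p))
    (hF : ∀ᵐ x ∂volume.restrict U, F' x = ((F x : ℝ) : ℂ))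
    (hq : ∀ᵐ x ∂volume.restrict U, q' x = complexVector (q x))
    {u : H10 ℝ U} {ψ : H10 ℂ U} (hu : stiffness G u = load G F q)
    (hψ : IsComplexificationOf ψ u) : stiffness G' ψ = load G' F' q' := by
  rw [← sub_eq_zero]
  refine eq_zero_of_forall_complexification fun χ φ hχ => ?_
  have hreal := congrArg (fun ξ => ((⟪φ, ξ⟫_ℝ : ℝ) : ℂ)) hu
  simp only [inner_stiffness, inner_load, Complex.ofReal_sub, ← integral_complex_ofReal] at hreal
  -- Tested against complexified real functions only, the complex equation is the real one seen in
  -- `ℂ`.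
  rw [inner_sub_right, sub_eq_zero, inner_stiffness, inner_load]
  convert hreal using 1
  · refine integral_congr_ae ?_
    filter_upwards [hG, hψ.grad_ae, hχ.grad_ae] with x h1 h2 h3
    rw [h2, h3, h1, inner_complexVector]
  · congr 1
    · refine integral_congr_ae ?_
      filter_upwards [hF, hχ.1] with x h1 h2
      rw [h1, h2]
      simp
    · refine integral_congr_ae ?_
      filter_upwards [hG, hq, hχ.grad_ae] with x h1 h2 h3
      rw [h2, h3, h1, inner_complexVector]

end WeakFormulation

/-! ### Measurability and holomorphy of the coefficient. -/

section CoefficientField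

open scoped Matrix.Norms.L2Operator InnerProductSpace

variable {d : ℕ} {𝕜 : Type*} [RCLike 𝕜]

theorem toEuclideanCLM_complexMatrix (A : Matrix (Fin d) (Fin d) ℝ)
    (p : EuclideanSpace ℝ (Fin d)) :
    Matrix.toEuclideanCLM (n := Fin d) (𝕜 := ℂ) (complexMatrix A) (complexVector p) =
      complexVector (Matrix.toEuclideanCLM (n := Fin d) (𝕜 := ℝ) A p) := by
  ext i
  simp [Matrix.mulVec, dotProduct]

theorem norm_le_norm_complexMatrix (A : Matrix (Fin d) (Fin d) ℝ) : ‖A‖ ≤ ‖complexMatrix A‖ := by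
  rw [← Matrix.l2_opNorm_toEuclideanCLM]
  refine ContinuousLinearMap.opNorm_le_bound _ (norm_nonneg _) fun p => ?_
  rw [← norm_complexVector, ← toEuclideanCLM_complexMatrix, ← norm_complexVector p]
  exact ContinuousLinearMap.le_opNorm _ _

/-- Matrix inversion is not continuous at singular matrices. Writing the inverse as the adjugate
over the determinant leaves only a scalar inversion, which is measurable everywhere. -/
theorem aestronglyMeasurable_coefficientMatrix {X : Type*} [MeasurableSpace X] {ν : Measure X}
    {a : X → ℝ} (ha : AEStronglyMeasurable a ν) {J : X → Matrix (Fin d) (Fin d) 𝕜}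
    (hJ : AEStronglyMeasurable J ν) :
    AEStronglyMeasurable (fun x => coefficientMatrix (a x) (J x)) ν := by
  have hdet : ∀ {M : X → Matrix (Fin d) (Fin d) 𝕜}, AEStronglyMeasurable M ν →
      AEStronglyMeasurable (fun x => (M x).det) ν :=
    fun hM => (continuous_id.matrix_det).comp_aestronglyMeasurable hM
  have hprod : AEStronglyMeasurable (fun x => (J x).transpose * J x) ν :=
    (continuous_id.matrix_transpose.matrix_mul continuous_id).comp_aestronglyMeasurable hJ
  have hadj : AEStronglyMeasurable (fun x => ((J x).transpose * J x).adjugate) ν :=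
    (continuous_id.matrix_adjugate).comp_aestronglyMeasurable hprod
  simp only [coefficientMatrix, Matrix.inv_def, Ring.inverse_eq_inv']
  have hinv : AEStronglyMeasurable (fun x => ((J x).transpose * J x).det⁻¹) ν :=
    (hdet hprod).aemeasurable.inv.aestronglyMeasurable
  have ha' : AEStronglyMeasurable (fun x => (a x : 𝕜)) ν :=
    RCLike.continuous_ofReal.comp_aestronglyMeasurable ha
  exact (ha'.mul (hdet hJ)).smul (hinv.smul hadj)

theorem continuous_toEuclideanCLM :
    Continuous (Matrix.toEuclideanCLM (n := Fin d) (𝕜 := 𝕜)) :=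
  LinearMap.continuous_of_finiteDimensional
    (Matrix.toEuclideanCLM (n := Fin d) (𝕜 := 𝕜)).toAlgEquiv.toLinearMap

variable {E : Type*} [NormedAddCommGroup E] [NormedSpace ℂ E]

theorem DifferentiableAt.clm_of_finiteDimensional {F G : Type*} [NormedAddCommGroup F]
    [NormedSpace ℂ F] [NormedAddCommGroup G] [NormedSpace ℂ G] [FiniteDimensional ℂ F]
    (L : F →ₗ[ℂ] G) {g : E → F} {z : E} (hg : DifferentiableAt ℂ g z) :
    DifferentiableAt ℂ (fun z => L (g z)) z :=
  (LinearMap.toContinuousLinearMap L).differentiableAt.comp z hg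

theorem DifferentiableAt.matrix_det {J : E → Matrix (Fin d) (Fin d) ℂ} {z : E}
    (hJ : DifferentiableAt ℂ J z) : DifferentiableAt ℂ (fun z => (J z).det) z := by
  have h : ∀ i j, DifferentiableAt ℂ (fun z => J z i j) z := fun i j =>
    hJ.clm_of_finiteDimensional (Matrix.entryLinearMap ℂ ℂ i j)
  simp only [Matrix.det_apply]
  fun_prop

theorem differentiableAt_coefficientMatrix {J : E → Matrix (Fin d) (Fin d) ℂ} {z : E} (a : ℝ)
    (hJ : DifferentiableAt ℂ J z) (hu : IsUnit (J z).det) :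
    DifferentiableAt ℂ (fun z => Matrix.toEuclideanCLM (n := Fin d) (𝕜 := ℂ)
      (coefficientMatrix a (J z))) z := by
  have hinv : DifferentiableAt ℂ (fun z => (J z)⁻¹) z := by
    simp only [Matrix.nonsing_inv_eq_ringInverse]
    have : CompleteSpace (Matrix (Fin d) (Fin d) ℂ) := FiniteDimensional.complete ℂ _
    exact (differentiableAt_inverse ((Matrix.isUnit_iff_isUnit_det _).2 hu)).comp z hJ
  have htr : DifferentiableAt ℂ (fun z => ((J z)⁻¹).transpose) z :=
    hinv.clm_of_finiteDimensional
      (Matrix.transposeLinearEquiv (Fin d) (Fin d) ℂ ℂ).toLinearMap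
  simp only [coefficientMatrix_eq]
  exact ((hJ.matrix_det.const_mul _).smul (hinv.mul htr)).clm_of_finiteDimensional
    (Matrix.toEuclideanCLM (n := Fin d) (𝕜 := ℂ)).toAlgEquiv.toLinearMap

end CoefficientField

/-! ### Holomorphic dependence of the solution on the parameter. -/

section ParametricProblem

open Metric
open scoped InnerProductSpace

variable {d : ℕ} {U : Set (EuclideanSpace ℝ (Fin d))}
  {E : Type*} [NormedAddCommGroup E] [NormedSpace ℂ E]

theorem DifferentiableAt.ringInverse_apply {H : Type*} [NormedAddCommGroup H] [NormedSpace ℂ H]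
    [CompleteSpace H] {A : E → H →L[ℂ] H} {l : E → H} {z : E} (hA : DifferentiableAt ℂ A z)
    (hu : IsUnit (A z)) (hl : DifferentiableAt ℂ l z) :
    DifferentiableAt ℂ (fun z => Ring.inverse (A z) (l z)) z :=
  (hA.inverse hu).clm_apply hl

theorem ContinuousLinearMap.ringInverse_apply_eq {H : Type*} [NormedAddCommGroup H]
    [NormedSpace ℂ H] {A : H →L[ℂ] H} (hu : IsUnit A) {l ψ : H} (h : A ψ = l) :
    Ring.inverse A l = ψ := by
  rw [← h, ← mul_apply_eq_comp, Ring.inverse_mul_cancel _ hu, one_apply_eq_self]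

/-- The weak solution of an elliptic problem is a holomorphic function of the parameter if the
coefficient and the right-hand side are. -/
theorem exists_differentiableOn_solution (hd : 1 ≤ d) (hU : Bornology.IsBounded U)
    {g : EuclideanSpace ℝ (Fin d) → E → EuclideanSpace ℂ (Fin d) →L[ℂ] EuclideanSpace ℂ (Fin d)}
    {s : EuclideanSpace ℝ (Fin d) → E → ℂ}
    (q : Lp (EuclideanSpace ℂ (Fin d)) 2 (volume.restrict U)) {V : Set E} (hV : IsOpen V)
    (hgm : ∀ z ∈ V, AEStronglyMeasurable (fun x => g x z) (volume.restrict U))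
    (hsm : ∀ z ∈ V, AEStronglyMeasurable (fun x => s x z) (volume.restrict U))
    (hgd : ∀ᵐ x ∂volume.restrict U, DifferentiableOn ℂ (g x) V)
    (hsd : ∀ᵐ x ∂volume.restrict U, DifferentiableOn ℂ (s x) V)
    (hgb : ∃ K, ∀ᵐ x ∂volume.restrict U, ∀ z ∈ V, ‖g x z‖ ≤ K)
    (hsb : ∀ R, ∃ K, ∀ᵐ x ∂volume.restrict U, ∀ z ∈ V ∩ ball 0 R, ‖s x z‖ ≤ K)
    {c : ℝ} (hc : 0 < c)
    (hcoer : ∀ᵐ x ∂volume.restrict U, ∀ z ∈ V, ∀ p, c * ‖p‖ ^ 2 ≤ (⟪p, g x z p⟫_ℂ).re) :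
    ∃ Ψ : E → H10 ℂ U, DifferentiableOn ℂ Ψ V ∧ ∀ z ∈ V, ∃
      (G : Lp (EuclideanSpace ℂ (Fin d) →L[ℂ] EuclideanSpace ℂ (Fin d)) ⊤ (volume.restrict U))
      (F : Lp ℂ 2 (volume.restrict U)),
      (G =ᵐ[volume.restrict U] fun x => g x z) ∧ (F =ᵐ[volume.restrict U] fun x => s x z) ∧
      ∀ ψ, stiffness G ψ = load G F q → Ψ z = ψ := by
  classical
  have : IsFiniteMeasure (volume.restrict U) := ⟨by simpa using hU.measure_lt_top⟩
  obtain ⟨K, hK⟩ := hgb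
  have hgmem : ∀ z ∈ V, MemLp (fun x => g x z) ⊤ (volume.restrict U) := fun z hz =>
    memLp_top_of_bound (hgm z hz) K (hK.mono fun x hx => hx z hz)
  have hsmem : ∀ z ∈ V, MemLp (fun x => s x z) ⊤ (volume.restrict U) := fun z hz => by
    obtain ⟨L, hL⟩ := hsb (‖z‖ + 1)
    exact memLp_top_of_bound (hsm z hz) L (hL.mono fun x hx => hx z ⟨hz, by simp⟩)
  let G : E → Lp (EuclideanSpace ℂ (Fin d) →L[ℂ] EuclideanSpace ℂ (Fin d)) ⊤
      (volume.restrict U) := fun z => if h : z ∈ V then (hgmem z h).toLp _ else 0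
  let S : E → Lp ℂ ⊤ (volume.restrict U) := fun z => if h : z ∈ V then (hsmem z h).toLp _ else 0
  have hG : ∀ z ∈ V, G z =ᵐ[volume.restrict U] fun x => g x z := fun z hz => by
    simp only [G, dif_pos hz]
    exact (hgmem z hz).coeFn_toLp
  have hS : ∀ z ∈ V, S z =ᵐ[volume.restrict U] fun x => s x z := fun z hz => by
    simp only [S, dif_pos hz]
    exact (hsmem z hz).coeFn_toLp
  have hGd : ∀ z ∈ V, DifferentiableAt ℂ G z := fun z hz => by
    obtain ⟨R, hR, hRV⟩ := Metric.isOpen_iff.1 hV z hz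
    exact differentiableAt_Lp_top hR (fun z' hz' => hG z' (hRV hz'))
      (hgd.mono fun x hx => hx.mono hRV) (hK.mono fun x hx z' hz' => hx z' (hRV hz'))
  have hSd : ∀ z ∈ V, DifferentiableAt ℂ S z := fun z hz => by
    obtain ⟨R, hR, hRV⟩ := Metric.isOpen_iff.1 hV z hz
    obtain ⟨L, hL⟩ := hsb (‖z‖ + R)
    refine differentiableAt_Lp_top hR (fun z' hz' => hS z' (hRV hz'))
      (hsd.mono fun x hx => hx.mono hRV) (hL.mono fun x hx z' hz' => hx z' ⟨hRV hz', ?_⟩)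
    rw [mem_ball_zero_iff]
    have h1 : ‖z' - z‖ < R := by rwa [← dist_eq_norm]
    have h2 := norm_sub_norm_le z' z
    linarith
  -- Multiplication by the constant `1 ∈ L²` is a bounded linear embedding of `L^∞` into `L²`, so
  -- the source stays holomorphic as an `L²` function.
  let one : Lp ℂ 2 (volume.restrict U) := (memLp_const (1 : ℂ)).toLp _
  have hone : one =ᵐ[volume.restrict U] fun _ => 1 := MemLp.coeFn_toLp _
  let T := ((ContinuousLinearMap.mul ℂ ℂ).holderL (volume.restrict U) ⊤ 2 2).flip one
  have hT : ∀ z ∈ V, T (S z) =ᵐ[volume.restrict U] fun x => s x z := fun z hz => by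
    filter_upwards [(ContinuousLinearMap.mul ℂ ℂ).coeFn_holder (r := 2) (S z) one, hone, hS z hz]
      with x h1 h2 h3
    refine h1.trans ?_
    rw [h2, h3]
    simp
  have hunit : ∀ z ∈ V, IsUnit (stiffness (G z)) := fun z hz => by
    refine isUnit_stiffness hd hU hc ?_
    filter_upwards [hcoer, hG z hz] with x h1 h2 p
    rw [h2]
    exact h1 z hz p
  refine ⟨fun z => Ring.inverse (stiffness (G z)) (load (G z) (T (S z)) q), fun z hz => ?_,
    fun z hz => ⟨G z, T (S z), hG z hz, hT z hz, fun ψ hψ => ?_⟩⟩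
  · have hmul : DifferentiableAt ℂ (fun z => mulField ℂ U (G z)) z :=
      (mulField ℂ U).differentiableAt.comp z (hGd z hz)
    have hst : DifferentiableAt ℂ (fun z => stiffness (G z)) z := by
      unfold stiffness
      exact (differentiableAt_const _).clm_comp (hmul.clm_comp (differentiableAt_const _))
    have hload : DifferentiableAt ℂ (fun z => load (G z) (T (S z)) q) z := by
      unfold load
      have h1 : DifferentiableAt ℂ (fun z => T (S z)) z :=
        T.differentiableAt.comp z (hSd z hz)
      have h2 : DifferentiableAt ℂ (fun z => mulField ℂ U (G z) q) z :=
        hmul.clm_apply (differentiableAt_const _)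
      exact ((h10FunL ℂ U).adjoint.differentiableAt.comp z h1).sub
        ((h10GradL ℂ U).adjoint.differentiableAt.comp z h2)
    exact (hst.ringInverse_apply (hunit z hz) hload).differentiableWithinAt
  · exact ContinuousLinearMap.ringInverse_apply_eq (hunit z hz) hψ

/-- The remapped weak formulation as an equation in `H¹₀(U)`. -/
theorem isRemappedSolution_iff {N : ℕ} {μ : Fin N → ℝ}
    {b : Fin N → EuclideanSpace ℝ (Fin d) → ℝ}
    {Db : Fin N → EuclideanSpace ℝ (Fin d) → EuclideanSpace ℝ (Fin d)}
    {v : EuclideanSpace ℝ (Fin d) → EuclideanSpace ℝ (Fin d)}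
    {a f : EuclideanSpace ℝ (Fin d) → ℝ}
    {Dw : EuclideanSpace ℝ (Fin d) → EuclideanSpace ℝ (Fin d)} {y : Fin N → ℝ}
    {G : Lp (EuclideanSpace ℝ (Fin d) →L[ℝ] EuclideanSpace ℝ (Fin d)) ⊤ (volume.restrict U)}
    {F : Lp ℝ 2 (volume.restrict U)}
    {q : Lp (EuclideanSpace ℝ (Fin d)) 2 (volume.restrict U)}
    (hG : G =ᵐ[volume.restrict U] fun x => Matrix.toEuclideanCLM (n := Fin d) (𝕜 := ℝ)
      (pulledBackCoefficient (a x) (domainJacobian μ b Db v y x)))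
    (hF : F =ᵐ[volume.restrict U] fun x =>
      f (domainMap μ b v y x) * |(domainJacobian μ b Db v y x).det|)
    (hq : q =ᵐ[volume.restrict U] Dw) (u : H10 ℝ U) :
    IsRemappedSolution U μ b Db v a f Dw y u ↔ stiffness G u = load G F q := by
  -- The remapped problem has the solution on the left of the matrix and the inner products have the
  -- test function there; symmetry of `C⁻¹` reconciles them.
  have hsymm : ∀ x (p r : Fin d → ℝ), p ⬝ᵥ Matrix.mulVec
      (pulledBackCoefficient (a x) (domainJacobian μ b Db v y x)) r = r ⬝ᵥ Matrix.mulVec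
      (pulledBackCoefficient (a x) (domainJacobian μ b Db v y x)) p := fun x p r => by
    have h : (pulledBackCoefficient (a x) (domainJacobian μ b Db v y x)).transpose =
        pulledBackCoefficient (a x) (domainJacobian μ b Db v y x) := by
      simp [pulledBackCoefficient, Matrix.transpose_smul, Matrix.transpose_nonsing_inv,
        Matrix.transpose_mul]
    rw [Matrix.dotProduct_mulVec, ← Matrix.mulVec_transpose, h, dotProduct_comm]
  have h1 : ∀ φ : H10 ℝ U, ∫ x in U, (h10Grad u x).ofLp ⬝ᵥ
      Matrix.mulVec (pulledBackCoefficient (a x) (domainJacobian μ b Db v y x))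
        (h10Grad φ x).ofLp = ⟪φ, stiffness G u⟫_ℝ := fun φ => by
    rw [inner_stiffness]
    refine integral_congr_ae ?_
    filter_upwards [hG] with x hx
    rw [hx, Matrix.inner_toEuclideanCLM, hsymm]
  have h2 : ∀ φ : H10 ℝ U, (∫ x in U, f (domainMap μ b v y x) *
      |(domainJacobian μ b Db v y x).det| * h10Fun φ x) - (∫ x in U, (Dw x).ofLp ⬝ᵥ
      Matrix.mulVec (pulledBackCoefficient (a x) (domainJacobian μ b Db v y x))
        (h10Grad φ x).ofLp) = ⟪φ, load G F q⟫_ℝ := fun φ => by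
    rw [inner_load]
    congr 1
    · refine integral_congr_ae ?_
      filter_upwards [hF] with x hx
      rw [hx]
      simp
    · refine integral_congr_ae ?_
      filter_upwards [hG, hq] with x hx hx'
      rw [hx, hx', Matrix.inner_toEuclideanCLM, hsymm]
  unfold IsRemappedSolution
  simp only [h1, h2]
  exact ⟨fun h => ext_inner_left ℝ h, fun h φ => by rw [h]⟩

end ParametricProblem

/-! ### The domain map and its Jacobian at complex parameters. -/

section DomainMap

open Metric
open scoped Matrix.Norms.L2Operator InnerProductSpace

variable {d N : ℕ}

theorem norm_sum_smul_le {𝕜 : Type*} [RCLike 𝕜] (m : Fin N → ℝ) (hm : ∀ l, 0 ≤ m l)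
    (c : Fin N → 𝕜) (B : Fin N → Matrix (Fin d) (Fin d) 𝕜) {r : Fin N → ℝ}
    (hr : ∀ l, ‖B l‖ ≤ r l) : ‖∑ l, ((m l : 𝕜) * c l) • B l‖ ≤ ∑ l, r l * m l * ‖c l‖ := by
  refine norm_sum_le_of_le _ fun l _ => ?_
  rw [norm_smul, norm_mul, RCLike.norm_ofReal, abs_of_nonneg (hm l)]
  have := mul_le_mul_of_nonneg_left (hr l) (mul_nonneg (hm l) (norm_nonneg (c l)))
  linarith

/-- The Jacobian of the domain map for complex parameters. -/
noncomputable def complexJacobian (μ : Fin N → ℝ) (b : Fin N → EuclideanSpace ℝ (Fin d) → ℝ)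
    (Db : Fin N → EuclideanSpace ℝ (Fin d) → EuclideanSpace ℝ (Fin d))
    (v : EuclideanSpace ℝ (Fin d) → EuclideanSpace ℝ (Fin d)) (z : Fin N → ℂ)
    (x : EuclideanSpace ℝ (Fin d)) : Matrix (Fin d) (Fin d) ℂ :=
  1 + ∑ l, ((√(μ l) : ℂ) * z l) • complexMatrix (perturbationMatrix (b l) (Db l) v x)

/-- The domain map for complex parameters. -/
noncomputable def complexDomainMap (μ : Fin N → ℝ) (b : Fin N → EuclideanSpace ℝ (Fin d) → ℝ)
    (v : EuclideanSpace ℝ (Fin d) → EuclideanSpace ℝ (Fin d)) (z : Fin N → ℂ)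
    (x : EuclideanSpace ℝ (Fin d)) : Fin d → ℂ :=
  fun i => (x i : ℂ) + (∑ l, (√(μ l) * b l x : ℝ) * z l) * (v x i : ℂ)

variable {μ : Fin N → ℝ} {b : Fin N → EuclideanSpace ℝ (Fin d) → ℝ}
  {Db : Fin N → EuclideanSpace ℝ (Fin d) → EuclideanSpace ℝ (Fin d)}
  {v : EuclideanSpace ℝ (Fin d) → EuclideanSpace ℝ (Fin d)}

theorem complexMatrix_sum_smul (m c : Fin N → ℝ) (B : Fin N → Matrix (Fin d) (Fin d) ℝ) :
    complexMatrix (∑ l, (m l * c l) • B l) = ∑ l, ((m l : ℂ) * c l) • complexMatrix (B l) := by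
  ext i j
  simp [Matrix.sum_apply]

theorem complexMatrix_domainJacobian (y : Fin N → ℝ) (x : EuclideanSpace ℝ (Fin d)) :
    complexMatrix (domainJacobian μ b Db v y x) =
      complexJacobian μ b Db v (fun l => (y l : ℂ)) x := by
  rw [complexJacobian, ← complexMatrix_sum_smul, domainJacobian]
  simp [complexMatrix, Matrix.map_add]

theorem complexDomainMap_ofReal (y : Fin N → ℝ) (x : EuclideanSpace ℝ (Fin d)) :
    complexDomainMap μ b v (fun l => (y l : ℂ)) x = fun i => (domainMap μ b v y x i : ℂ) := by
  ext i
  simp [complexDomainMap, domainMap]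

/-- Splitting of the complex Jacobian into a real part close to the identity and a small
complex perturbation, together with its imaginary part. -/
theorem exists_complexJacobian_eq {δ β : ℝ} {x : EuclideanSpace ℝ (Fin d)}
    (hB : ∑ l, spectralNorm₂ (perturbationMatrix (b l) (Db l) v x) * √(μ l) ≤ 1 - δ)
    {y : Fin N → ℝ} (hy : y ∈ Icc (-1 : Fin N → ℝ) 1) {z : Fin N → ℂ}
    (hz : ∑ l, spectralNorm₂ (perturbationMatrix (b l) (Db l) v x) * √(μ l) * ‖z l - y l‖ ≤ β) :
    ∃ (E S : Matrix (Fin d) (Fin d) ℝ) (W : Matrix (Fin d) (Fin d) ℂ),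
      ‖E‖ ≤ 1 - δ ∧ ‖S‖ ≤ β ∧ ‖W‖ ≤ β ∧
      W.map star = W - (2 * Complex.I) • complexMatrix S ∧
      domainJacobian μ b Db v y x = 1 + E ∧
      complexJacobian μ b Db v z x = 1 + (complexMatrix E + W) := by
  set B := fun l => perturbationMatrix (b l) (Db l) v x with hBdef
  have hnorm : ∀ l, spectralNorm₂ (B l) = ‖B l‖ := fun l => rfl
  -- `E` comes from the real point `y` and `W` from `z - y`. As `y` is real, the imaginary parts of
  -- `z` and `z - y` agree, which gives `S` and its bound.
  refine ⟨∑ l, (√(μ l) * y l) • B l, ∑ l, (√(μ l) * (z l).im) • B l,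
    ∑ l, ((√(μ l) : ℂ) * (z l - y l)) • complexMatrix (B l), ?_, ?_, ?_, ?_, rfl, ?_⟩
  · refine (norm_sum_smul_le (𝕜 := ℝ) _ (fun l => Real.sqrt_nonneg _) y B
      fun l => (hnorm l).ge).trans (le_trans (Finset.sum_le_sum fun l _ => ?_) hB)
    refine mul_le_of_le_one_right (mul_nonneg (norm_nonneg _) (Real.sqrt_nonneg _)) ?_
    rw [Real.norm_eq_abs, abs_le]
    exact ⟨hy.1 l, hy.2 l⟩
  · refine (norm_sum_smul_le (𝕜 := ℝ) _ (fun l => Real.sqrt_nonneg _) (fun l => (z l).im) B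
      fun l => (hnorm l).ge).trans (le_trans (Finset.sum_le_sum fun l _ => ?_) hz)
    refine mul_le_mul_of_nonneg_left ?_ (mul_nonneg (norm_nonneg _) (Real.sqrt_nonneg _))
    have h := Complex.abs_im_le_norm (z l - y l)
    simpa using h
  · exact (norm_sum_smul_le (𝕜 := ℂ) _ (fun l => Real.sqrt_nonneg _) (fun l => z l - y l)
      (fun l => complexMatrix (B l)) fun l => norm_complexMatrix_le (B l)).trans hz
  · ext i j
    simp only [complexMatrix_sum_smul, Matrix.map_apply, Matrix.sub_apply, Matrix.smul_apply,
      Matrix.sum_apply, star_sum, Finset.smul_sum, ← Finset.sum_sub_distrib]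
    refine Finset.sum_congr rfl fun l _ => ?_
    apply Complex.ext
    · simp
    · simp; ring
  · rw [complexJacobian, complexMatrix_sum_smul, ← Finset.sum_add_distrib]
    congr 1
    refine Finset.sum_congr rfl fun l _ => ?_
    rw [← add_smul]
    congr 1
    ring

variable {U : Set (EuclideanSpace ℝ (Fin d))}

theorem aestronglyMeasurable_perturbationMatrix (hU : IsOpen U) (hv : ContDiffOn ℝ 1 v U)
    {b : EuclideanSpace ℝ (Fin d) → ℝ}
    {Db : EuclideanSpace ℝ (Fin d) → EuclideanSpace ℝ (Fin d)}
    (hb : MemSobolevOne ⊤ U b Db) :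
    AEStronglyMeasurable (perturbationMatrix b Db v) (volume.restrict U) := by
  have hcoord : ∀ {q : EuclideanSpace ℝ (Fin d) → EuclideanSpace ℝ (Fin d)} (i : Fin d),
      AEStronglyMeasurable q (volume.restrict U) →
      AEStronglyMeasurable (fun x => q x i) (volume.restrict U) := fun i hq =>
    (EuclideanSpace.proj i : EuclideanSpace ℝ (Fin d) →L[ℝ] ℝ).continuous.comp_aestronglyMeasurable
      hq
  have hvm : AEStronglyMeasurable v (volume.restrict U) :=
    hv.continuousOn.aestronglyMeasurable hU.measurableSet
  have hDv : ∀ j, AEStronglyMeasurable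
      (fun x => fderiv ℝ v x (EuclideanSpace.single j 1)) (volume.restrict U) := fun j =>
    ((hv.continuousOn_fderiv_of_isOpen hU le_rfl).clm_apply
      continuousOn_const).aestronglyMeasurable hU.measurableSet
  have h : perturbationMatrix b Db v = fun x => ∑ i, ∑ j,
      (b x * (fderiv ℝ v x (EuclideanSpace.single j 1)) i + v x i * Db x j) •
        Matrix.single i j (1 : ℝ) := by
    funext x
    conv_lhs => rw [Matrix.matrix_eq_sum_single (perturbationMatrix b Db v x)]
    simp [perturbationMatrix]
  rw [h]
  refine Finset.aestronglyMeasurable_fun_sum _ fun i _ =>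
    Finset.aestronglyMeasurable_fun_sum _ fun j _ => ?_
  exact ((hb.1.1.mul (hcoord i (hDv j))).add
    ((hcoord i hvm).mul (hcoord j hb.2.1.1))).smul_const _

theorem aestronglyMeasurable_domainJacobian (hU : IsOpen U) (hv : ContDiffOn ℝ 1 v U)
    (hb : ∀ l, MemSobolevOne ⊤ U (b l) (Db l)) (y : Fin N → ℝ) :
    AEStronglyMeasurable (domainJacobian μ b Db v y) (volume.restrict U) := by
  have h : domainJacobian μ b Db v y = fun x => 1 + ∑ l, (√(μ l) * y l) •
      perturbationMatrix (b l) (Db l) v x := rfl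
  rw [h]
  exact aestronglyMeasurable_const.add (Finset.aestronglyMeasurable_fun_sum _ fun l _ =>
    (aestronglyMeasurable_perturbationMatrix hU hv (hb l)).fun_const_smul _)

theorem aestronglyMeasurable_complexJacobian (hU : IsOpen U) (hv : ContDiffOn ℝ 1 v U)
    (hb : ∀ l, MemSobolevOne ⊤ U (b l) (Db l)) (z : Fin N → ℂ) :
    AEStronglyMeasurable (complexJacobian μ b Db v z) (volume.restrict U) := by
  have hc : Continuous (complexMatrix (d := d)) :=
    continuous_id.matrix_map Complex.continuous_ofReal
  have h : complexJacobian μ b Db v z = fun x => 1 + ∑ l, ((√(μ l) : ℂ) * z l) •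
      complexMatrix (perturbationMatrix (b l) (Db l) v x) := rfl
  rw [h]
  exact aestronglyMeasurable_const.add (Finset.aestronglyMeasurable_fun_sum _ fun l _ =>
    (hc.comp_aestronglyMeasurable
      (aestronglyMeasurable_perturbationMatrix hU hv (hb l))).fun_const_smul _)

theorem aestronglyMeasurable_complexDomainMap (hU : IsOpen U) (hv : ContDiffOn ℝ 1 v U)
    (hb : ∀ l, MemSobolevOne ⊤ U (b l) (Db l)) (z : Fin N → ℂ) :
    AEStronglyMeasurable (complexDomainMap μ b v z) (volume.restrict U) := by
  have hcoord : ∀ {q : EuclideanSpace ℝ (Fin d) → EuclideanSpace ℝ (Fin d)} (i : Fin d),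
      AEMeasurable q (volume.restrict U) →
      AEMeasurable (fun x => (q x i : ℂ)) (volume.restrict U) := fun i hq =>
    Complex.measurable_ofReal.comp_aemeasurable
      ((EuclideanSpace.proj i :
        EuclideanSpace ℝ (Fin d) →L[ℝ] ℝ).continuous.measurable.comp_aemeasurable hq)
  refine (aemeasurable_pi_iff.2 fun i => ?_ : AEMeasurable _ _).aestronglyMeasurable
  refine (hcoord i aemeasurable_id).add (AEMeasurable.mul ?_
    (hcoord i (hv.continuousOn.aestronglyMeasurable hU.measurableSet).aemeasurable))
  exact Finset.aemeasurable_fun_sum _ fun l _ => (Complex.measurable_ofReal.comp_aemeasurable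
    ((hb l).1.1.aemeasurable.const_mul _)).mul_const _

theorem differentiable_complexJacobian (x : EuclideanSpace ℝ (Fin d)) :
    Differentiable ℂ fun z => complexJacobian μ b Db v z x := by
  unfold complexJacobian
  fun_prop

theorem differentiable_complexDomainMap (x : EuclideanSpace ℝ (Fin d)) :
    Differentiable ℂ fun z => complexDomainMap μ b v z x := by
  unfold complexDomainMap
  fun_prop

/-- The perturbation `√μₗ bₗ v` of the identity is bounded. -/
theorem exists_bound_displacement (hU : Bornology.IsBounded U)
    (hD : ∀ y ∈ Icc (-1 : Fin N → ℝ) 1, Bornology.IsBounded (domainMap μ b v y '' U)) :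
    ∃ M : ℝ, 0 ≤ M ∧ ∀ x ∈ U, ‖x‖ ≤ M ∧ ∀ l, |√(μ l) * b l x| * ‖v x‖ ≤ M := by
  classical
  obtain ⟨M₀, hM₀⟩ := hU.exists_norm_le
  have h : ∀ l, ∃ M, ∀ x ∈ U, |√(μ l) * b l x| * ‖v x‖ ≤ M := fun l => by
    -- At the unit vector `y = e_l` the image and `U` are both bounded, hence so is the displacement
    -- `√μₗ bₗ v`; no bound on `v` alone is assumed.
    have hmem : (Pi.single l 1 : Fin N → ℝ) ∈ Icc (-1 : Fin N → ℝ) 1 := by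
      constructor <;> intro k <;> obtain rfl | hk := eq_or_ne k l <;> simp [*]
    obtain ⟨M, hM⟩ := (hD _ hmem).exists_norm_le
    refine ⟨M + M₀, fun x hx => ?_⟩
    have h1 : domainMap μ b v (Pi.single l 1) x = x + (√(μ l) * b l x) • v x := by
      rw [domainMap, Finset.sum_eq_single l] <;> simp +contextual
    have h2 := hM _ (mem_image_of_mem _ hx)
    rw [h1] at h2
    have h3 := norm_sub_le (x + (√(μ l) * b l x) • v x) x
    rw [add_sub_cancel_left, norm_smul, Real.norm_eq_abs] at h3
    linarith [hM₀ x hx]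
  choose M hM using h
  refine ⟨|M₀| + ∑ l, |M l|, by positivity, fun x hx => ⟨?_, fun l => ?_⟩⟩
  · exact (hM₀ x hx).trans ((le_abs_self _).trans
      (le_add_of_nonneg_right (Finset.sum_nonneg fun l _ => abs_nonneg _)))
  · refine (hM l x hx).trans ((le_abs_self _).trans ?_)
    have := Finset.single_le_sum (f := fun l => |M l|) (fun l _ => abs_nonneg _)
      (Finset.mem_univ l)
    have h0 := abs_nonneg M₀
    linarith

theorem norm_complexDomainMap_le {M R : ℝ} {x : EuclideanSpace ℝ (Fin d)}
    (hx : ‖x‖ ≤ M) (hxv : ∀ l, |√(μ l) * b l x| * ‖v x‖ ≤ M) (hM : 0 ≤ M) (hR : 0 ≤ R)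
    {z : Fin N → ℂ} (hz : ‖z‖ ≤ R) : ‖complexDomainMap μ b v z x‖ ≤ M + N * (M * R) := by
  refine (pi_norm_le_iff_of_nonneg (by positivity)).2 fun i => ?_
  refine (norm_add_le _ _).trans (add_le_add ?_ ?_)
  · rw [Complex.norm_real]
    exact (PiLp.norm_apply_le x i).trans hx
  · rw [Finset.sum_mul]
    refine (norm_sum_le_of_le _ fun l _ => ?_).trans (b := ∑ _l : Fin N, M * R) (by simp)
    rw [norm_mul, norm_mul, Complex.norm_real, Complex.norm_real, Real.norm_eq_abs]
    have h1 := mul_le_mul_of_nonneg_left (PiLp.norm_apply_le (v x) i)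
      (abs_nonneg (√(μ l) * b l x))
    have h2 := (norm_le_pi_norm z l).trans hz
    nlinarith [norm_nonneg (z l), hxv l, norm_nonneg (v x i),
      mul_le_mul (h1.trans (hxv l)) h2 (norm_nonneg _) hM]

/-- Almost everywhere bound of the perturbation matrices by their essential suprema. -/
theorem ae_spectralNorm₂_le {δ : ℝ}
    (hB : ∀ᵐ x ∂volume.restrict U,
      ∑ l, spectralNorm₂ (perturbationMatrix (b l) (Db l) v x) * √(μ l) ≤ 1 - δ) :
    ∀ᵐ x ∂volume.restrict U, ∀ l, spectralNorm₂ (perturbationMatrix (b l) (Db l) v x) * √(μ l) ≤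
      supSpectralNorm U (perturbationMatrix (b l) (Db l) v) * √(μ l) := by
  rw [ae_all_iff]
  intro l
  have hnn : ∀ l x, 0 ≤ spectralNorm₂ (perturbationMatrix (b l) (Db l) v x) :=
    fun l x => norm_nonneg _
  -- If `μ l = 0`, both sides vanish. Otherwise `hB` makes the essential supremum finite, so its
  -- `toReal` is its true value rather than the default `0`.
  obtain h0 | hpos := (Real.sqrt_nonneg (μ l)).eq_or_lt
  · simp [← h0]
  have hbd : ∀ᵐ x ∂volume.restrict U,
      ‖spectralNorm₂ (perturbationMatrix (b l) (Db l) v x)‖ ≤ (1 - δ) / √(μ l) := by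
    filter_upwards [hB] with x hx
    rw [Real.norm_of_nonneg (hnn l x), le_div_iff₀ hpos]
    exact (Finset.single_le_sum (f := fun l => spectralNorm₂ (perturbationMatrix (b l) (Db l) v x) *
      √(μ l)) (fun l _ => mul_nonneg (hnn l x) (Real.sqrt_nonneg _)) (Finset.mem_univ l)).trans hx
  have hfin : eLpNormEssSup (fun x => spectralNorm₂ (perturbationMatrix (b l) (Db l) v x))
      (volume.restrict U) ≠ ⊤ :=
    ((eLpNormEssSup_le_of_ae_bound hbd).trans_lt ENNReal.ofReal_lt_top).ne
  filter_upwards [enorm_ae_le_eLpNormEssSup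
    (fun x => spectralNorm₂ (perturbationMatrix (b l) (Db l) v x)) (volume.restrict U)] with x hx
  refine mul_le_mul_of_nonneg_right ?_ hpos.le
  have h1 := ENNReal.toReal_mono hfin hx
  rw [toReal_enorm, Real.norm_of_nonneg (hnn l x)] at h1
  rwa [supSpectralNorm, eLpNorm_exponent_top]

end DomainMap

/-! ### Numerical consequences of the choice of `γ`. -/

section Constants

/-- `γ = 1 + δ^d / (δ^d + (2-δ)^d)`, and the fraction is at most `1/2` because `δ ≤ 2 - δ`. -/
theorem gammaConst_bounds (d : ℕ) {δ : ℝ} (hδ0 : 0 < δ) (hδ1 : δ < 1) :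
    1 < gammaConst d δ ∧ gammaConst d δ ≤ 3 / 2 := by
  have h1 : 0 < δ ^ d := pow_pos hδ0 d
  have h2 : δ ^ d ≤ (2 - δ) ^ d := pow_le_pow_left₀ hδ0.le (by linarith) d
  have h3 : 0 < δ ^ d + (2 - δ) ^ d := by linarith
  constructor
  · rw [gammaConst, one_lt_div h3]; linarith
  · rw [gammaConst, div_le_iff₀ h3]; linarith

/-- The bounds on the radius of the complex perturbation that give coercivity. -/
theorem radius_bounds {d : ℕ} (hd : 1 ≤ d) {δ : ℝ} (hδ0 : 0 < δ) (hδ1 : δ < 1) {r : ℝ}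
    (hr : r = δ * (Real.log (gammaConst d δ) / (d + Real.log (gammaConst d δ)))) :
    0 < r ∧ r < δ ∧ Real.exp (d * (r / δ)) ≤ 3 / 2 ∧ 2 * r ≤ 0.84 * (δ - r) := by
  obtain ⟨hγ1, hγ2⟩ := gammaConst_bounds d hδ0 hδ1
  set L := Real.log (gammaConst d δ) with hL
  have hL0 : 0 < L := Real.log_pos hγ1
  -- `1 + 0.42 + 0.42²/2 = 1.5082` exceeds `3/2 ≥ γ`.
  have hL1 : L ≤ 0.42 := by
    rw [hL, Real.log_le_iff_le_exp (by linarith)]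
    have := Real.quadratic_le_exp_of_nonneg (x := 0.42) (by norm_num)
    linarith
  have hd' : (1 : ℝ) ≤ d := by exact_mod_cast hd
  have hdL : 0 < d + L := by linarith
  -- Equivalently `d r = L (δ - r)`. This yields `d r / δ ≤ L` and, as `d ≥ 1`, also `r ≤ L (δ - r)
  -- ≤ 0.42 (δ - r)`.
  have hrd : r * (d + L) = δ * L := by rw [hr]; field_simp
  have hr0 : 0 < r := by rw [hr]; positivity
  refine ⟨hr0, by nlinarith, ?_, by nlinarith⟩
  have h1 : d * (r / δ) ≤ L := by
    rw [← mul_div_assoc, div_le_iff₀ hδ0]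
    nlinarith
  calc Real.exp (d * (r / δ)) ≤ Real.exp L := Real.exp_le_exp.2 h1
    _ = gammaConst d δ := Real.exp_log (by linarith)
    _ ≤ 3 / 2 := hγ2

end Constants

/-! ### Uniform bounds over the complex parameter region. -/

section ParameterRegion

open Metric
open scoped Matrix.Norms.L2Operator InnerProductSpace

variable {d N : ℕ} {U : Set (EuclideanSpace ℝ (Fin d))} {μ : Fin N → ℝ}
  {b : Fin N → EuclideanSpace ℝ (Fin d) → ℝ}
  {Db : Fin N → EuclideanSpace ℝ (Fin d) → EuclideanSpace ℝ (Fin d)}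
  {v : EuclideanSpace ℝ (Fin d) → EuclideanSpace ℝ (Fin d)}

variable (U μ b Db v) in
/-- The open complex neighbourhood of `[-1,1]^N` of radius `r` in the weighted `ℓ¹` norm. -/
def openComplexRegion (r : ℝ) : Set (Fin N → ℂ) :=
  {z | ∃ y ∈ Icc (-1 : Fin N → ℝ) 1,
    ∑ l, supSpectralNorm U (perturbationMatrix (b l) (Db l) v) * √(μ l) * ‖z l - y l‖ < r}

theorem isOpen_openComplexRegion (r : ℝ) : IsOpen (openComplexRegion U μ b Db v r) := by
  have h : openComplexRegion U μ b Db v r = ⋃ y ∈ Icc (-1 : Fin N → ℝ) 1, {z : Fin N → ℂ |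
      ∑ l, supSpectralNorm U (perturbationMatrix (b l) (Db l) v) * √(μ l) * ‖z l - y l‖ < r} := by
    ext z
    simp [openComplexRegion]
  rw [h]
  exact isOpen_biUnion fun y _ => isOpen_lt (by fun_prop) continuous_const

theorem complexRegion_subset {β r : ℝ} (h : β < r) :
    complexRegion U μ b Db v β ⊆ openComplexRegion U μ b Db v r := by
  rintro z ⟨y, hy, w, hw, hsum⟩
  refine ⟨y, hy, lt_of_le_of_lt (le_of_eq ?_) (hsum.trans_lt h)⟩
  simp [hw]

theorem ofReal_mem_openComplexRegion {r : ℝ} (hr : 0 < r) {y : Fin N → ℝ}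
    (hy : y ∈ Icc (-1 : Fin N → ℝ) 1) :
    (fun l => (y l : ℂ)) ∈ openComplexRegion U μ b Db v r :=
  ⟨y, hy, by simpa using hr⟩

/-- Bounds for the coefficient and the Jacobian determinant over the complex region. -/
theorem coefficientMatrix_complexJacobian_bounds {δ r a amin amax : ℝ} (hδ0 : 0 < δ) (hδ1 : δ < 1)
    (hr0 : 0 < r) (hr1 : r < δ) (hr2 : Real.exp (d * (r / δ)) ≤ 3 / 2)
    (hr3 : 2 * r ≤ 0.84 * (δ - r)) (hamin : 0 < amin) (ha : amin ≤ a ∧ a ≤ amax)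
    {x : EuclideanSpace ℝ (Fin d)}
    (hB : ∑ l, spectralNorm₂ (perturbationMatrix (b l) (Db l) v x) * √(μ l) ≤ 1 - δ)
    (hS : ∀ l, spectralNorm₂ (perturbationMatrix (b l) (Db l) v x) * √(μ l) ≤
      supSpectralNorm U (perturbationMatrix (b l) (Db l) v) * √(μ l))
    {z : Fin N → ℂ} (hz : z ∈ openComplexRegion U μ b Db v r) :
    IsUnit (complexJacobian μ b Db v z x).det ∧
      ‖(complexJacobian μ b Db v z x).det‖ ≤ Real.exp d ∧
      ‖coefficientMatrix a (complexJacobian μ b Db v z x)‖ ≤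
        amax * Real.exp d * ((δ - r)⁻¹ * (δ - r)⁻¹) ∧
      ∀ p : EuclideanSpace ℂ (Fin d), amin * δ ^ d / 400 * ‖p‖ ^ 2 ≤
        (⟪p, Matrix.toEuclideanCLM (n := Fin d) (𝕜 := ℂ)
          (coefficientMatrix a (complexJacobian μ b Db v z x)) p⟫_ℂ).re := by
  obtain ⟨y, hy, hsum⟩ := hz
  obtain ⟨E, S, W, hE, hSn, hW, hWS, -, hJ⟩ := exists_complexJacobian_eq hB hy
    ((Finset.sum_le_sum fun l _ => mul_le_mul_of_nonneg_right (hS l) (norm_nonneg _)).trans hsum.le)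
  have hEW : ‖complexMatrix E + W‖ ≤ 1 - (δ - r) :=
    (norm_add_le _ _).trans (by linarith [norm_complexMatrix_le E])
  have hε : 0 < δ - r := sub_pos.2 hr1
  rw [hJ]
  refine ⟨(norm_one_add_inv_le hε hEW).1, (norm_det_one_add_le _).trans ?_,
    norm_coefficientMatrix_le ?_ hε hEW, fun p => ?_⟩
  · refine Real.exp_le_exp.2 (mul_le_of_le_one_right (Nat.cast_nonneg d) (by linarith))
  · rw [abs_of_pos (hamin.trans_le ha.1)]
    exact ha.2
  · exact coefficientMatrix_coercive hδ0 hδ1 hr0.le hr2 hr3 hr1 hamin.le ha.1 hE hSn hW hWS p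

theorem det_domainJacobian_pos {δ : ℝ} (hδ0 : 0 < δ) {x : EuclideanSpace ℝ (Fin d)}
    (hB : ∑ l, spectralNorm₂ (perturbationMatrix (b l) (Db l) v x) * √(μ l) ≤ 1 - δ)
    {y : Fin N → ℝ} (hy : y ∈ Icc (-1 : Fin N → ℝ) 1) :
    0 < (domainJacobian μ b Db v y x).det := by
  obtain ⟨E, S, W, hE, -, -, -, hJ, -⟩ := exists_complexJacobian_eq (β := 0) hB hy
    (z := fun l => (y l : ℂ)) (by simp)
  rw [hJ]
  exact det_one_add_pos (by linarith)

/-- Replaces `|det J|`, which has no holomorphic extension as written, by the polynomial `det J`. -/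
theorem pulledBackCoefficient_eq {a : ℝ} {J : Matrix (Fin d) (Fin d) ℝ} (hJ : 0 < J.det) :
    pulledBackCoefficient a J = coefficientMatrix a J := by
  rw [pulledBackCoefficient, coefficientMatrix, abs_of_pos hJ]
  rfl

end ParameterRegion

/-! ### The main theorem. -/

theorem mainTheorem1 {d N : ℕ} (hd : 1 ≤ d)
    (U : Set (EuclideanSpace ℝ (Fin d))) (hUo : IsOpen U) (hUb : Bornology.IsBounded U)
    -- the domain map `F(x, y) = x + (∑ₗ √μₗ bₗ(x) yₗ) v(x)`
    (μ : Fin N → ℝ) (hμ : ∀ l, 0 ≤ μ l)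
    (b : Fin N → EuclideanSpace ℝ (Fin d) → ℝ)
    (Db : Fin N → EuclideanSpace ℝ (Fin d) → EuclideanSpace ℝ (Fin d))
    (hb : ∀ l, MemSobolevOne ⊤ U (b l) (Db l))
    (v : EuclideanSpace ℝ (Fin d) → EuclideanSpace ℝ (Fin d)) (hv : ContDiffOn ℝ 1 v U)
    (hD : ∀ y ∈ Set.Icc (-1 : Fin N → ℝ) 1, Bornology.IsBounded (domainMap μ b v y '' U))
    -- the smallness condition on the perturbation
    (δ : ℝ) (hδ0 : 0 < δ) (hδ1 : δ < 1)
    (hB : ∀ᵐ x ∂MeasureTheory.volume.restrict U,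
      ∑ l, spectralNorm₂ (perturbationMatrix (b l) (Db l) v x) * √(μ l) ≤ 1 - δ)
    -- the diffusion coefficient `a ∘ F`, as a function on the reference domain
    (a : EuclideanSpace ℝ (Fin d) → ℝ)
    (ha : MeasureTheory.AEStronglyMeasurable a (MeasureTheory.volume.restrict U))
    (amin amax : ℝ) (hamin : 0 < amin)
    (habd : ∀ᵐ x ∂MeasureTheory.volume.restrict U, amin ≤ a x ∧ a x ≤ amax)
    -- the right-hand side, with an extension to an entire function on `ℂ^d`
    (f : EuclideanSpace ℝ (Fin d) → ℝ)
    (hf : ∃ fC : (Fin d → ℂ) → ℂ, Differentiable ℂ fC ∧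
      ∀ x : EuclideanSpace ℝ (Fin d), fC (fun i => (x i : ℂ)) = (f x : ℂ))
    -- the extension `w ∈ H¹(U)` of the boundary data
    (w : EuclideanSpace ℝ (Fin d) → ℝ)
    (Dw : EuclideanSpace ℝ (Fin d) → EuclideanSpace ℝ (Fin d))
    (hw : MemSobolevOne 2 U w Dw)
    (β : ℝ)
    (hβ : β < min (δ * (Real.log (gammaConst d δ) / (d + Real.log (gammaConst d δ))))
      (√(1 + δ ^ 2 / 2) - 1)) :
    (∀ y ∈ Set.Icc (-1 : Fin N → ℝ) 1,
      ∃! u : H10 ℝ U, IsRemappedSolution U μ b Db v a f Dw y u) ∧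
    ∃ (V : Set (Fin N → ℂ)) (Ψ : (Fin N → ℂ) → H10 ℂ U),
      IsOpen V ∧ complexRegion U μ b Db v β ⊆ V ∧ DifferentiableOn ℂ Ψ V ∧
      ∀ y ∈ Set.Icc (-1 : Fin N → ℝ) 1, ∀ u : H10 ℝ U,
        IsRemappedSolution U μ b Db v a f Dw y u →
          IsComplexificationOf (Ψ fun l => (y l : ℂ)) u := by
  obtain ⟨fC, hfC, hfr⟩ := hf
  have : IsFiniteMeasure (volume.restrict U) := ⟨by simpa using hUb.measure_lt_top⟩
  obtain ⟨r, hr⟩ : ∃ r,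
      r = δ * (Real.log (gammaConst d δ) / (d + Real.log (gammaConst d δ))) := ⟨_, rfl⟩
  obtain ⟨hr0, hr1, hr2, hr3⟩ := radius_bounds hd hδ0 hδ1 hr
  have hβr : β < r := hr ▸ hβ.trans_le (min_le_left _ _)
  -- The gap `β < r` makes room for an open set around `Θ_β`.
  set V := openComplexRegion U μ b Db v r
  obtain ⟨M, hM0, hM⟩ := exists_bound_displacement hUb hD
  set K := amax * Real.exp d * ((δ - r)⁻¹ * (δ - r)⁻¹)
  have hbounds : ∀ᵐ x ∂volume.restrict U, ∀ z ∈ V,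
      IsUnit (complexJacobian μ b Db v z x).det ∧
      ‖(complexJacobian μ b Db v z x).det‖ ≤ Real.exp d ∧
      ‖Matrix.toEuclideanCLM (n := Fin d) (𝕜 := ℂ)
        (coefficientMatrix (a x) (complexJacobian μ b Db v z x))‖ ≤ K ∧
      ∀ p : EuclideanSpace ℂ (Fin d), amin * δ ^ d / 400 * ‖p‖ ^ 2 ≤
        (inner ℂ p (Matrix.toEuclideanCLM (n := Fin d) (𝕜 := ℂ)
          (coefficientMatrix (a x) (complexJacobian μ b Db v z x)) p)).re := by
    filter_upwards [hB, ae_spectralNorm₂_le hB, habd] with x h1 h2 h3 z hz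
    exact coefficientMatrix_complexJacobian_bounds hδ0 hδ1 hr0 hr1 hr2 hr3 hamin h3 h1 h2 hz
  have hc : 0 < amin * δ ^ d / 400 := by positivity
  -- `V` is unbounded in directions of zero weight, where the domain map may still move. The entire
  -- function `fC` is therefore bounded on balls only.
  have hsb : ∀ R, ∃ K', ∀ᵐ x ∂volume.restrict U, ∀ z ∈ V ∩ Metric.ball 0 R,
      ‖fC (complexDomainMap μ b v z x) * (complexJacobian μ b Db v z x).det‖ ≤ K' := fun R => by
    obtain ⟨K', hK'⟩ := (isCompact_closedBall (0 : Fin d → ℂ)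
      (M + N * (M * |R|))).exists_bound_of_continuousOn hfC.continuous.continuousOn
    refine ⟨K' * Real.exp d, ?_⟩
    filter_upwards [hbounds, ae_restrict_mem hUo.measurableSet] with x h1 hx z hz
    have h2 : ‖fC (complexDomainMap μ b v z x)‖ ≤ K' :=
      hK' _ (mem_closedBall_zero_iff.2 (norm_complexDomainMap_le (hM x hx).1 (hM x hx).2 hM0
        (abs_nonneg R) ((mem_ball_zero_iff.1 hz.2).le.trans (le_abs_self R))))
    rw [norm_mul]
    exact mul_le_mul h2 (h1 z hz.1).2.1 (norm_nonneg _) ((norm_nonneg _).trans h2)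
  have hsm : ∀ z, AEStronglyMeasurable (fun x => fC (complexDomainMap μ b v z x) *
      (complexJacobian μ b Db v z x).det) (volume.restrict U) := fun z =>
    (hfC.continuous.comp_aestronglyMeasurable
      (aestronglyMeasurable_complexDomainMap hUo hv hb z)).mul
    (continuous_id.matrix_det.comp_aestronglyMeasurable
      (aestronglyMeasurable_complexJacobian hUo hv hb z))
  let q : Lp (EuclideanSpace ℝ (Fin d)) 2 (volume.restrict U) := hw.2.1.toLp Dw
  have hq : q =ᵐ[volume.restrict U] Dw := hw.2.1.coeFn_toLp
  obtain ⟨Ψ, hΨ, hΨsol⟩ := exists_differentiableOn_solution hd hUb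
    (g := fun x z => Matrix.toEuclideanCLM (n := Fin d) (𝕜 := ℂ)
      (coefficientMatrix (a x) (complexJacobian μ b Db v z x)))
    (s := fun x z => fC (complexDomainMap μ b v z x) * (complexJacobian μ b Db v z x).det)
    (complexVector.compLp q) (isOpen_openComplexRegion (U := U) (μ := μ) (b := b) (Db := Db)
      (v := v) r)
    (fun z _ => continuous_toEuclideanCLM.comp_aestronglyMeasurable
      (aestronglyMeasurable_coefficientMatrix ha
        (aestronglyMeasurable_complexJacobian hUo hv hb z)))
    (fun z _ => hsm z)
    (hbounds.mono fun x hx z hz => (differentiableAt_coefficientMatrix (a x)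
      (differentiable_complexJacobian x z) (hx z hz).1).differentiableWithinAt)
    (.of_forall fun x => ((hfC.comp (differentiable_complexDomainMap x)).mul
      fun z => (differentiable_complexJacobian x z).matrix_det).differentiableOn)
    ⟨K, hbounds.mono fun x hx z hz => (hx z hz).2.2.1⟩ hsb hc
    (hbounds.mono fun x hx z hz => (hx z hz).2.2.2)
  -- At real `y`, the real coefficient and source are those of the complex family, so measurability,
  -- bounds and coercivity are inherited from it.
  have hreal : ∀ y ∈ Icc (-1 : Fin N → ℝ) 1, ∃
      (G : Lp (EuclideanSpace ℝ (Fin d) →L[ℝ] EuclideanSpace ℝ (Fin d)) ⊤ (volume.restrict U))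
      (F : Lp ℝ 2 (volume.restrict U)),
      (∀ u, IsRemappedSolution U μ b Db v a f Dw y u ↔ stiffness G u = load G F q) ∧
      IsUnit (stiffness G) ∧
      (∀ᵐ x ∂volume.restrict U, ∀ p, Matrix.toEuclideanCLM (n := Fin d) (𝕜 := ℂ)
        (coefficientMatrix (a x) (complexJacobian μ b Db v (fun l => (y l : ℂ)) x))
          (complexVector p) = complexVector (G x p)) ∧
      ∀ᵐ x ∂volume.restrict U, fC (complexDomainMap μ b v (fun l => (y l : ℂ)) x) *
        (complexJacobian μ b Db v (fun l => (y l : ℂ)) x).det = ((F x : ℝ) : ℂ) := fun y hy => by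
    have hyV : (fun l => (y l : ℂ)) ∈ V := ofReal_mem_openComplexRegion hr0 hy
    have hcoef : ∀ᵐ x ∂volume.restrict U,
        pulledBackCoefficient (a x) (domainJacobian μ b Db v y x) =
          coefficientMatrix (a x) (domainJacobian μ b Db v y x) := by
      filter_upwards [hB] with x hx
      exact pulledBackCoefficient_eq (det_domainJacobian_pos hδ0 hx hy)
    have hsrc : ∀ᵐ x ∂volume.restrict U, fC (complexDomainMap μ b v (fun l => (y l : ℂ)) x) *
        (complexJacobian μ b Db v (fun l => (y l : ℂ)) x).det =
          ((f (domainMap μ b v y x) * |(domainJacobian μ b Db v y x).det| : ℝ) : ℂ) := by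
      filter_upwards [hB] with x hx
      rw [complexDomainMap_ofReal, hfr, ← complexMatrix_domainJacobian, det_complexMatrix,
        abs_of_pos (det_domainJacobian_pos hδ0 hx hy), Complex.ofReal_mul]
    have hGmem : MemLp (fun x => Matrix.toEuclideanCLM (n := Fin d) (𝕜 := ℝ)
        (pulledBackCoefficient (a x) (domainJacobian μ b Db v y x))) ⊤ (volume.restrict U) := by
      refine memLp_top_of_bound (AEStronglyMeasurable.congr
        (continuous_toEuclideanCLM.comp_aestronglyMeasurable
          (aestronglyMeasurable_coefficientMatrix ha
            (aestronglyMeasurable_domainJacobian (μ := μ) hUo hv hb y)))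
        (hcoef.mono fun x hx => congrArg _ hx.symm)) K ?_
      filter_upwards [hcoef, hbounds] with x h1 h2
      rw [h1]
      refine (norm_le_norm_complexMatrix _).trans ?_
      rw [complexMatrix_coefficientMatrix, complexMatrix_domainJacobian]
      exact (h2 _ hyV).2.2.1
    have hFmem : MemLp (fun x => f (domainMap μ b v y x) *
        |(domainJacobian μ b Db v y x).det|) 2 (volume.restrict U) := by
      obtain ⟨K', hK'⟩ := hsb (‖fun l => (y l : ℂ)‖ + 1)
      refine MemLp.of_bound (AEStronglyMeasurable.congr
        (Complex.continuous_re.comp_aestronglyMeasurable (hsm fun l => (y l : ℂ)))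
        (hsrc.mono fun x hx => by simp only [hx, Complex.ofReal_re])) K' ?_
      filter_upwards [hsrc, hK'] with x h1 h2
      rw [← Complex.norm_real, ← h1]
      exact h2 _ ⟨hyV, by simp⟩
    have hG := hGmem.coeFn_toLp
    have hF := hFmem.coeFn_toLp
    have hpoint : ∀ᵐ x ∂volume.restrict U, ∀ p, Matrix.toEuclideanCLM (n := Fin d) (𝕜 := ℂ)
        (coefficientMatrix (a x) (complexJacobian μ b Db v (fun l => (y l : ℂ)) x))
          (complexVector p) = complexVector (hGmem.toLp _ x p) := by
      filter_upwards [hG, hcoef] with x h1 h2 p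
      rw [h1, h2, ← toEuclideanCLM_complexMatrix, complexMatrix_coefficientMatrix,
        complexMatrix_domainJacobian]
    refine ⟨hGmem.toLp _, hFmem.toLp _, fun u => isRemappedSolution_iff hG hF hq u,
      isUnit_stiffness hd hUb hc ?_, hpoint, ?_⟩
    -- Real coercivity is complex coercivity evaluated at real vectors.
    · filter_upwards [hpoint, hbounds] with x h1 h2 p
      have h3 := (h2 _ hyV).2.2.2 (complexVector p)
      rw [h1, inner_complexVector, norm_complexVector, Complex.ofReal_re] at h3
      exact h3
    · filter_upwards [hsrc, hF] with x h1 h2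
      rw [h1, h2]
  refine ⟨fun y hy => ?_, V, Ψ, isOpen_openComplexRegion r, complexRegion_subset hβr, hΨ,
    fun y hy u hu => ?_⟩
  · obtain ⟨G, F, hiff, hunit, -, -⟩ := hreal y hy
    simp only [hiff]
    exact (ContinuousLinearMap.isUnit_iff_bijective.1 hunit).existsUnique _
  · obtain ⟨G, F, hiff, -, hGc, hFc⟩ := hreal y hy
    obtain ⟨G', F', hG', hF', hsol⟩ := hΨsol _ (ofReal_mem_openComplexRegion hr0 hy)
    obtain ⟨ψ, hψ⟩ := exists_complexification u
    have h := stiffness_eq_load_of_isComplexificationOf (G' := G') (F' := F')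
      (q' := complexVector.compLp q) (by
        filter_upwards [hG', hGc] with x h1 h2 p
        rw [h1, h2]) (by
        filter_upwards [hF', hFc] with x h1 h2
        rw [h1, h2]) (complexVector.coeFn_compLp q) ((hiff u).1 hu) hψ
    rw [hsol ψ h]
    exact hψ
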